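/- Let $d_A,d_B\ge 1$, let $\alpha,\beta,\gamma\in\mathbb R$, and consider the linear map on $M_{d_A}(\mathbb C)\otimes M_{d_B}(\mathbb C)$ $$\Phi=\Phi[\alpha,\beta,\gamma]=\mathbb 1_{AB}\mathrm{Tr}+\alpha\,(\mathbb 1_A\mathrm{Tr})\otimes I_B+\beta\, I_A\otimes(\mathbb 1_B\mathrm{Tr})+\gamma\, I_{AB},$$ where $I$ is the identity map and $\mathbb 1\mathrm{Tr}$ is the map $X\mapsto \mathrm{Tr}(X)\,\mathbb 1$. A linear map $\Psi$ is completely positive (CP) if $(\Psi\otimes I_k)(\rho)\ge 0$ for all $k$ and all positive semidefinite $\rho$; it is PPT if $T\Psi$ is CP, where $T$ is the transposition; and it is entanglement-breaking if for all $k$ and all positive semidefinite $\rho$ the matrix $(\Psi\otimes I_k)(\rho)$ is separable between the output system and the $k$-dimensional ancilla, i.e. is a finite sum of tensor products of positive semidefinite matrices. 1. If $d_A=d_B$, then $\Phi$ is entanglement-breaking if and only if $\Phi$ is CP and PPT. 2. If $d_A<d_B$, then $\Phi$ is entanglement-breaking if and only if the three maps $\Phi$, $\ T\Phi\ $ and $\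 \big(I_A\otimes(\mathbb 1\mathrm{Tr}-\tfrac{I}{d_A})_B\big)\Phi\ $ are all CP. 3. If $d_A>d_B$, then $\Phi$ is entanglement-breaking if and only if the three maps $\Phi$, $\ T\Phi\ $ and $\ \big((\mathbb 1\mathrm{Tr}-\tfrac{I}{d_B})_A\otimes I_B\big)\Phi\ $ are all CP. -/

import Mathlib

open scoped Kronecker ComplexOrder

noncomputable section

namespace BipartiteDepolarizing

/-- The tensor product `f ⊗ g` of two linear maps between matrix algebras, acting on matrices
indexed by a product of index types (`M_{m} ⊗ M_{n}` is identified with `M_{m × n}` by the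
Kronecker product). -/
def tensorMap {m m' n n' : Type*} [Fintype m] [Fintype m'] [Fintype n] [Fintype n']
    [DecidableEq m] [DecidableEq m'] [DecidableEq n] [DecidableEq n']
    (f : Matrix m m ℂ →ₗ[ℂ] Matrix m' m' ℂ) (g : Matrix n n ℂ →ₗ[ℂ] Matrix n' n' ℂ) :
    Matrix (m × n) (m × n) ℂ →ₗ[ℂ] Matrix (m' × n') (m' × n') ℂ :=
  (kroneckerLinearEquiv m' m' n' n' ℂ).toLinearMap ∘ₗ
    TensorProduct.map f g ∘ₗ (kroneckerLinearEquiv m m n n ℂ).symm.toLinearMap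

/-- `f ⊗ g` is characterised by its values on product matrices. -/
theorem tensorMap_kronecker {m m' n n' : Type*} [Fintype m] [Fintype m'] [Fintype n] [Fintype n']
    [DecidableEq m] [DecidableEq m'] [DecidableEq n] [DecidableEq n']
    (f : Matrix m m ℂ →ₗ[ℂ] Matrix m' m' ℂ) (g : Matrix n n ℂ →ₗ[ℂ] Matrix n' n' ℂ)
    (X : Matrix m m ℂ) (Y : Matrix n n ℂ) :
    tensorMap f g (X ⊗ₖ Y) = f X ⊗ₖ g Y := by
  simp [tensorMap]

/-- Complete positivity: `f ⊗ id_k` preserves positive semidefiniteness for every ancilla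
dimension `k`. -/
def IsCompletelyPositive {m m' : Type*} [Fintype m] [Fintype m'] [DecidableEq m] [DecidableEq m']
    (f : Matrix m m ℂ →ₗ[ℂ] Matrix m' m' ℂ) : Prop :=
  ∀ (k : ℕ) (ρ : Matrix (m × Fin k) (m × Fin k) ℂ), ρ.PosSemidef →
    (tensorMap f (LinearMap.id : Matrix (Fin k) (Fin k) ℂ →ₗ[ℂ] _) ρ).PosSemidef

/-- The (unnormalised) separable matrices of a bipartite system `m | n`: finite sums of products
of positive semidefinite matrices. -/
def IsSeparable {m n : Type*} (ρ : Matrix (m × n) (m × n) ℂ) : Prop :=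
  ∃ (r : ℕ) (A : Fin r → Matrix m m ℂ) (B : Fin r → Matrix n n ℂ),
    (∀ i, (A i).PosSemidef) ∧ (∀ i, (B i).PosSemidef) ∧ ρ = ∑ i, A i ⊗ₖ B i

/-- Entanglement-breaking: for every ancilla, `f ⊗ id_k` sends each positive semidefinite matrix
to a matrix that is separable between the output system and the ancilla. -/
def IsEntanglementBreaking {m m' : Type*} [Fintype m] [Fintype m'] [DecidableEq m]
    [DecidableEq m'] (f : Matrix m m ℂ →ₗ[ℂ] Matrix m' m' ℂ) : Prop :=
  ∀ (k : ℕ) (ρ : Matrix (m × Fin k) (m × Fin k) ℂ), ρ.PosSemidef →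
    IsSeparable (tensorMap f (LinearMap.id : Matrix (Fin k) (Fin k) ℂ →ₗ[ℂ] _) ρ)

/-- The transposition map `T`. -/
def transposeMap (m : Type*) : Matrix m m ℂ →ₗ[ℂ] Matrix m m ℂ :=
  (Matrix.transposeLinearEquiv m m ℂ ℂ).toLinearMap

/-- PPT (completely copositive) maps: `T ∘ f` is completely positive. -/
def IsPPT {m m' : Type*} [Fintype m] [Fintype m'] [DecidableEq m] [DecidableEq m']
    (f : Matrix m m ℂ →ₗ[ℂ] Matrix m' m' ℂ) : Prop :=
  IsCompletelyPositive (transposeMap m' ∘ₗ f)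

/-- The map `𝟙 Tr : X ↦ Tr(X) 𝟙`. -/
def oneTr (m : Type*) [Fintype m] [DecidableEq m] : Matrix m m ℂ →ₗ[ℂ] Matrix m m ℂ :=
  (Matrix.traceLinearMap m ℂ ℂ).smulRight (1 : Matrix m m ℂ)

/-- The bipartite depolarizing map
`Φ[α,β,γ] = 𝟙_{AB} Tr + α 𝟙_A Tr ⊗ I + β I ⊗ 𝟙_B Tr + γ I` on a `dA × dB` system. -/
def Phi (dA dB : ℕ) (α β γ : ℝ) :
    Matrix (Fin dA × Fin dB) (Fin dA × Fin dB) ℂ →ₗ[ℂ]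
      Matrix (Fin dA × Fin dB) (Fin dA × Fin dB) ℂ :=
  oneTr (Fin dA × Fin dB)
    + (α : ℂ) • tensorMap (oneTr (Fin dA)) LinearMap.id
    + (β : ℂ) • tensorMap LinearMap.id (oneTr (Fin dB))
    + (γ : ℂ) • LinearMap.id

/-- The map `𝟙 Tr - I / c` on the `d × d` matrices. -/
def reductionMap (d c : ℕ) : Matrix (Fin d) (Fin d) ℂ →ₗ[ℂ] Matrix (Fin d) (Fin d) ℂ :=
  oneTr (Fin d) - ((1 : ℂ) / (c : ℂ)) • LinearMap.id

end BipartiteDepolarizing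

end

noncomputable section

namespace BipartiteDepolarizing

/-! Sufficiency is a symmetry reduction. `mapMatrix` turns `Φ` into a combination of the four
operators on two copies of `A ⊗ B` that exchange, or not, the copies of `A` and those of `B`
(`mapMatrix_Phi`), and separability of this matrix makes `Φ` entanglement-breaking
(`isEntanglementBreaking_of_isSeparable`). The flips commute with all `(U ⊗ V) ⊗ (U ⊗ V)`. Averaging
a separable `J` over this group keeps it separable, keeps its traces against the flips, and lands in
the span of the flips, where these traces determine the operator. Hence one separable `J` with the
right four traces is enough (`isSeparable_flipSum`).

Let `N, a, b, c` be the traces against the identity, the flip of `A`, the flip of `B` and both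
flips, and let `d = min dA dB`. Suitable product matrices realise `(1,0,0,0)`, `(1,1,0,0)`,
`(1,0,1,0)`, `(1,1,1,1)` and `(1,1/d,1/d,1)`. When both dimensions are at least 2, their cone
contains every solution of `0 ≤ c ≤ d a`, `c ≤ d b`, `|a - b| ≤ N - c` and `a + b ≤ N + c`
(`attains_of_inequalities`). For `Φ`, the last two conditions come from PPT. CP gives `0 ≤ c`, `c ≤
dA b` and `c ≤ dB a`, which is everything when `dA = dB`. Otherwise one bound is needed with the
smaller dimension instead, and the third map supplies it.

Necessity: a positive map after an entanglement-breaking one is CP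
(`IsEntanglementBreaking.comp_positive`). The third map composes `Φ` with a map that is positive
because a vector of `A ⊗ B` has Schmidt rank at most `d` (`normSq_trace_conjTranspose_mul_le`). -/

/-! ### Compact convex hulls and fixed points of unitary conjugation -/

theorem sum_eq_sum_of_embedding {ι κ F : Type*} [Fintype ι] [Fintype κ] [AddCommMonoid F]
    (e : ι ↪ κ) {g : κ → F} {f : ι → F} (h1 : ∀ i, g (e i) = f i)
    (h2 : ∀ j, j ∉ Set.range e → g j = 0) : ∑ j, g j = ∑ i, f i := by
  rw [← Finset.sum_congr rfl fun i _ => h1 i, ← Finset.sum_map Finset.univ e g]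
  refine (Finset.sum_subset (Finset.subset_univ _) fun j _ hj => h2 j ?_).symm
  rintro ⟨i, rfl⟩
  exact hj (by simp)

/-- By Carathéodory, `finrank + 1` points suffice, so the hull is a continuous image of a simplex
times a power of `s`. -/
theorem isCompact_convexHull_of_isCompact {E : Type*} [AddCommGroup E] [Module ℝ E]
    [TopologicalSpace E] [ContinuousAdd E] [ContinuousSMul ℝ E] [FiniteDimensional ℝ E]
    {s : Set E} (hs : IsCompact s) : IsCompact (convexHull ℝ s) := by
  classical
  rcases s.eq_empty_or_nonempty with rfl | ⟨x₀, hx₀⟩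
  · simp
  set n := Module.finrank ℝ E + 1
  have hK : IsCompact ((fun p : (Fin n → ℝ) × (Fin n → E) => ∑ i, p.1 i • p.2 i) ''
      (stdSimplex ℝ (Fin n) ×ˢ Set.pi Set.univ fun _ => s)) := by
    refine ((isCompact_stdSimplex ℝ (Fin n)).prod (isCompact_univ_pi fun _ => hs)).image ?_
    fun_prop
  convert hK
  ext x
  constructor
  · intro hx
    obtain ⟨ι, _, z, w, hz, hind, hw, hw1, rfl⟩ := eq_pos_convex_span_of_mem_convexHull hx
    have hcard : Fintype.card ι ≤ n :=
      hind.card_le_finrank_succ.trans (Nat.succ_le_succ (Submodule.finrank_le _))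
    obtain ⟨e⟩ : Nonempty (ι ↪ Fin n) :=
      Function.Embedding.nonempty_of_card_le (by simpa using hcard)
    -- Unused slots get weight 0 and the dummy point `x₀`, which must lie in `s`.
    refine ⟨(Function.extend e w 0, Function.extend e z fun _ => x₀), ⟨⟨fun j => ?_, ?_⟩, ?_⟩, ?_⟩
    · by_cases h : ∃ i, e i = j
      · obtain ⟨i, rfl⟩ := h
        simpa [e.injective.extend_apply] using (hw i).le
      · simp [Function.extend_apply' _ _ _ h]
    · rw [← hw1]
      exact sum_eq_sum_of_embedding e (fun i => by simp only [e.injective.extend_apply])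
        fun j hj => by simpa using Function.extend_apply' w (0 : Fin n → ℝ) j hj
    · intro j _
      by_cases h : ∃ i, e i = j
      · obtain ⟨i, rfl⟩ := h
        simpa [e.injective.extend_apply] using hz ⟨i, rfl⟩
      · simpa [Function.extend_apply' _ _ _ h] using hx₀
    · exact sum_eq_sum_of_embedding e (fun i => by simp only [e.injective.extend_apply])
        fun j hj => by
          have := Function.extend_apply' w (0 : Fin n → ℝ) j hj
          simp [this]
  · rintro ⟨⟨w, z⟩, ⟨⟨hw, hw1⟩, hz⟩, rfl⟩
    exact (convex_convexHull ℝ s).sum_mem (fun i _ => hw i) hw1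
      fun i _ => subset_convexHull ℝ s (hz i trivial)

theorem isCompact_unitaryGroup (n : Type*) [Fintype n] [DecidableEq n] :
    IsCompact (Matrix.unitaryGroup n ℂ : Set (Matrix n n ℂ)) := by
  have hb : IsCompact (Set.pi Set.univ fun _ : n => Set.pi Set.univ fun _ : n =>
      Metric.closedBall (0 : ℂ) 1) :=
    isCompact_univ_pi fun _ => isCompact_univ_pi fun _ => isCompact_closedBall 0 1
  refine hb.of_isClosed_subset ?_ ?_
  · have : (Matrix.unitaryGroup n ℂ : Set (Matrix n n ℂ)) =
        {U : Matrix n n ℂ | U * star U = 1} := by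
      ext U; exact Matrix.mem_unitaryGroup_iff
    rw [this]
    exact isClosed_eq (by fun_prop) continuous_const
  · intro U hU i _ j _
    simpa using entry_norm_bound_of_unitary hU i j

/-- The squared Hilbert–Schmidt norm. -/
def normSqHS {n : Type*} [Fintype n] (J : Matrix n n ℂ) : ℝ := ∑ i, ∑ j, Complex.normSq (J i j)

theorem normSqHS_eq {n : Type*} [Fintype n] (J : Matrix n n ℂ) :
    normSqHS J = (J.conjTranspose * J).trace.re := by
  simp only [normSqHS, Matrix.trace, Matrix.diag, Matrix.mul_apply, Matrix.conjTranspose_apply,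
    Complex.re_sum]
  rw [Finset.sum_comm]
  refine Finset.sum_congr rfl fun i _ => Finset.sum_congr rfl fun j _ => ?_
  simp [Complex.normSq_apply]

theorem normSqHS_conj {n : Type*} [Fintype n] [DecidableEq n] (J W : Matrix n n ℂ)
    (hW : W ∈ Matrix.unitaryGroup n ℂ) : normSqHS (W * J * star W) = normSqHS J := by
  have h := Matrix.mem_unitaryGroup_iff'.1 hW
  rw [normSqHS_eq, normSqHS_eq]
  have : (W * J * star W).conjTranspose * (W * J * star W) =
      W * (J.conjTranspose * J) * star W := by
    calc _ = W * J.conjTranspose * (star W * W) * J * star W := by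
            simp [Matrix.star_eq_conjTranspose, Matrix.mul_assoc]
      _ = _ := by rw [h]; simp [Matrix.mul_assoc]
  rw [this, Matrix.trace_mul_comm, ← Matrix.mul_assoc, h, Matrix.one_mul]

theorem normSqHS_midpoint {n : Type*} [Fintype n] (J K : Matrix n n ℂ) :
    4 * normSqHS ((1 / 2 : ℝ) • J + (1 / 2 : ℝ) • K) + normSqHS (J - K) =
      2 * normSqHS J + 2 * normSqHS K := by
  simp only [normSqHS, Finset.mul_sum, ← Finset.sum_add_distrib]
  refine Finset.sum_congr rfl fun i _ => Finset.sum_congr rfl fun j _ => ?_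
  simp [Complex.normSq_apply]
  ring

/-- Replaces Haar averaging. The element of least Hilbert–Schmidt norm is unique by the
parallelogram law, and conjugation preserves the norm, so every unitary preserving `C` fixes it. -/
theorem exists_fixed_point_of_unitary_conj {n : Type*} [Fintype n] [DecidableEq n]
    {C : Set (Matrix n n ℂ)} (hc : IsCompact C) (hC : Convex ℝ C) (hne : C.Nonempty) :
    ∃ m ∈ C, ∀ W ∈ Matrix.unitaryGroup n ℂ, (∀ J ∈ C, W * J * star W ∈ C) →
      W * m * star W = m := by
  have hcont : Continuous (normSqHS : Matrix n n ℂ → ℝ) := by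
    unfold normSqHS
    refine continuous_finsetSum _ fun i _ => continuous_finsetSum _ fun j _ =>
      Complex.continuous_normSq.comp (by fun_prop)
  obtain ⟨m, hm, hmin⟩ := hc.exists_isMinOn hne hcont.continuousOn
  refine ⟨m, hm, fun W hW hWC => ?_⟩
  have h1 := normSqHS_midpoint (W * m * star W) m
  have h2 := normSqHS_conj m W hW
  have h3 : normSqHS m ≤ normSqHS ((1 / 2 : ℝ) • (W * m * star W) + (1 / 2 : ℝ) • m) :=
    hmin (hC (hWC m hm) hm (by norm_num) (by norm_num) (by norm_num))
  have h4 : normSqHS (W * m * star W - m) ≤ 0 := by linarith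
  ext i j
  have h5 : ∀ i ∈ Finset.univ, ∀ j ∈ Finset.univ,
      Complex.normSq ((W * m * star W - m) i j) = 0 := by
    have h0 := le_antisymm h4
      (Finset.sum_nonneg fun i _ => Finset.sum_nonneg fun j _ => Complex.normSq_nonneg _)
    intro i hi
    have := (Finset.sum_eq_zero_iff_of_nonneg
      (fun i _ => Finset.sum_nonneg fun j _ => Complex.normSq_nonneg _)).1 h0 i hi
    exact (Finset.sum_eq_zero_iff_of_nonneg (fun j _ => Complex.normSq_nonneg _)).1 this
  have := h5 i (Finset.mem_univ _) j (Finset.mem_univ _)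
  rw [Complex.normSq_eq_zero, Matrix.sub_apply, sub_eq_zero] at this
  exact this

/-! ### Tensor products of maps, separability and complete positivity -/

section TensorMap

variable {m m' m'' n n' n'' : Type*} [Fintype m] [Fintype m'] [Fintype m''] [Fintype n]
  [Fintype n'] [Fintype n''] [DecidableEq m] [DecidableEq m'] [DecidableEq m''] [DecidableEq n]
  [DecidableEq n'] [DecidableEq n'']

theorem linearMap_ext_kronecker {V : Type*} [AddCommGroup V] [Module ℂ V]
    {F G : Matrix (m × n) (m × n) ℂ →ₗ[ℂ] V}
    (h : ∀ (X : Matrix m m ℂ) (Y : Matrix n n ℂ), F (X ⊗ₖ Y) = G (X ⊗ₖ Y)) : F = G := by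
  have : F ∘ₗ (kroneckerLinearEquiv m m n n ℂ).toLinearMap =
      G ∘ₗ (kroneckerLinearEquiv m m n n ℂ).toLinearMap :=
    TensorProduct.ext' fun X Y => by simpa using h X Y
  ext1 ρ
  simpa using LinearMap.congr_fun this ((kroneckerLinearEquiv m m n n ℂ).symm ρ)

theorem tensorMap_comp (f' : Matrix m' m' ℂ →ₗ[ℂ] Matrix m'' m'' ℂ)
    (g' : Matrix n' n' ℂ →ₗ[ℂ] Matrix n'' n'' ℂ) (f : Matrix m m ℂ →ₗ[ℂ] Matrix m' m' ℂ)
    (g : Matrix n n ℂ →ₗ[ℂ] Matrix n' n' ℂ) :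
    tensorMap (f' ∘ₗ f) (g' ∘ₗ g) = tensorMap f' g' ∘ₗ tensorMap f g :=
  linearMap_ext_kronecker fun X Y => by simp [tensorMap_kronecker]

theorem tensorMap_id_right_apply (f : Matrix m m ℂ →ₗ[ℂ] Matrix m' m' ℂ)
    (ρ : Matrix (m × n) (m × n) ℂ) (p q : m') (k l : n) :
    tensorMap f (LinearMap.id : Matrix n n ℂ →ₗ[ℂ] _) ρ (p, k) (q, l) =
      f (ρ.submatrix (fun i => (i, k)) fun j => (j, l)) p q := by
  let F : Matrix (m × n) (m × n) ℂ →ₗ[ℂ] ℂ :=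
    { toFun := fun ρ => tensorMap f (LinearMap.id : Matrix n n ℂ →ₗ[ℂ] _) ρ (p, k) (q, l)
      map_add' := fun a b => by simp
      map_smul' := fun c a => by simp }
  let G : Matrix (m × n) (m × n) ℂ →ₗ[ℂ] ℂ :=
    { toFun := fun ρ => f (ρ.submatrix (fun i => (i, k)) fun j => (j, l)) p q
      map_add' := fun a b => by rw [Matrix.submatrix_add]; simp
      map_smul' := fun c a => by rw [Matrix.submatrix_smul]; simp }
  have : F = G := linearMap_ext_kronecker fun X Y => by
    have hs : (X ⊗ₖ Y).submatrix (fun i => (i, k)) (fun j => (j, l)) = Y k l • X := by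
      ext i j; simp [mul_comm]
    simp [F, G, tensorMap_kronecker, hs, mul_comm]
  exact LinearMap.congr_fun this ρ

theorem tensorMap_id_left_apply (g : Matrix n n ℂ →ₗ[ℂ] Matrix n' n' ℂ)
    (ρ : Matrix (m × n) (m × n) ℂ) (p q : m) (k l : n') :
    tensorMap (LinearMap.id : Matrix m m ℂ →ₗ[ℂ] _) g ρ (p, k) (q, l) =
      g (ρ.submatrix (fun i => (p, i)) fun j => (q, j)) k l := by
  let F : Matrix (m × n) (m × n) ℂ →ₗ[ℂ] ℂ :=
    { toFun := fun ρ => tensorMap (LinearMap.id : Matrix m m ℂ →ₗ[ℂ] _) g ρ (p, k) (q, l)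
      map_add' := fun a b => by simp
      map_smul' := fun c a => by simp }
  let G : Matrix (m × n) (m × n) ℂ →ₗ[ℂ] ℂ :=
    { toFun := fun ρ => g (ρ.submatrix (fun i => (p, i)) fun j => (q, j)) k l
      map_add' := fun a b => by rw [Matrix.submatrix_add]; simp
      map_smul' := fun c a => by rw [Matrix.submatrix_smul]; simp }
  have : F = G := linearMap_ext_kronecker fun X Y => by
    have hs : (X ⊗ₖ Y).submatrix (fun i => (p, i)) (fun j => (q, j)) = X p q • Y := by
      ext i j; simp
    simp [F, G, tensorMap_kronecker, hs]
  exact LinearMap.congr_fun this ρ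

theorem isEntanglementBreaking_of_measure_prepare {f : Matrix m m ℂ →ₗ[ℂ] Matrix m' m' ℂ} {r : ℕ}
    {A : Fin r → Matrix m' m' ℂ} {B : Fin r → Matrix m m ℂ} (hA : ∀ i, (A i).PosSemidef)
    (hB : ∀ i, (B i).PosSemidef) (hf : ∀ X, f X = ∑ i, (B i * X).trace • A i) :
    IsEntanglementBreaking f := by
  intro k ρ hρ
  refine ⟨r, A, fun i => Matrix.of fun a b =>
    (B i * ρ.submatrix (fun i => (i, a)) fun j => (j, b)).trace, hA, fun i => ?_, ?_⟩
  · obtain ⟨s, v, hv⟩ := Matrix.posSemidef_iff_eq_sum_vecMulVec.1 (hB i)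
    -- `K c` is the functional `⟨v c|` on the system tensored with the identity of the ancilla. Thus
    -- the ancilla factor is a sum of congruences of `ρ`.
    let K : Fin s → Matrix (Fin k) (m × Fin k) ℂ := fun c =>
      Matrix.of fun a jb => if a = jb.2 then star (v c jb.1) else 0
    have : (Matrix.of fun a b =>
        (B i * ρ.submatrix (fun i => (i, a)) fun j => (j, b)).trace) =
        ∑ c, K c * ρ * (K c).conjTranspose := by
      ext a b
      simp only [hv, Matrix.of_apply, Matrix.sum_mul, Matrix.trace_sum, Matrix.sum_apply]
      refine Finset.sum_congr rfl fun c _ => ?_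
      simp only [Matrix.trace, Matrix.diag, Matrix.mul_apply, Matrix.vecMulVec_apply,
        Matrix.submatrix_apply, Matrix.conjTranspose_apply, Matrix.of_apply, K,
        Fintype.sum_prod_type, apply_ite star, star_star, star_zero, ite_mul, zero_mul, mul_ite,
        mul_zero, Finset.sum_ite_eq, Finset.mem_univ, if_true, Pi.star_apply, Finset.sum_mul]
      refine Finset.sum_congr rfl fun i _ => ?_
      refine Finset.sum_congr rfl fun j _ => ?_
      ring
    beta_reduce
    rw [this]
    exact Matrix.posSemidef_sum _ fun c _ => hρ.mul_mul_conjTranspose_same _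
  · ext ⟨p, a⟩ ⟨q, b⟩
    rw [tensorMap_id_right_apply, hf]
    simp [Matrix.sum_apply, mul_comm]

/-- The matrix of `f` in the matrix-unit bases, arranged so that `X ↦ tr(B X) A` becomes
`A ⊗ B`. -/
def mapMatrix (f : Matrix m m ℂ →ₗ[ℂ] Matrix m' m' ℂ) : Matrix (m' × m) (m' × m) ℂ :=
  Matrix.of fun a b => f (Matrix.single b.2 a.2 1) a.1 b.1

theorem isEntanglementBreaking_of_isSeparable {f : Matrix m m ℂ →ₗ[ℂ] Matrix m' m' ℂ}
    (hf : IsSeparable (mapMatrix f)) : IsEntanglementBreaking f := by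
  obtain ⟨r, A, B, hA, hB, h⟩ := hf
  refine isEntanglementBreaking_of_measure_prepare hA hB fun X => ?_
  conv_lhs => rw [Matrix.matrix_eq_sum_single X]
  ext p q
  have h' : ∀ i j, f (Matrix.single i j 1) p q = ∑ c, A c p q * B c j i := fun i j => by
    have := congrFun (congrFun h (p, j)) (q, i)
    simpa [mapMatrix, Matrix.sum_apply] using this
  have h1 : ∀ i j, f (Matrix.single i j (X i j)) p q = X i j * ∑ c, A c p q * B c j i :=
    fun i j => by
      rw [← h', ← smul_eq_mul, ← Matrix.smul_apply, ← map_smul, Matrix.smul_single, smul_eq_mul,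
        mul_one]
  simp only [map_sum, Matrix.sum_apply, h1, Matrix.smul_apply, Matrix.trace, Matrix.diag,
    Matrix.mul_apply, smul_eq_mul, Finset.sum_mul, Finset.mul_sum]
  rw [Finset.sum_comm]
  conv_lhs => enter [2, j]; rw [Finset.sum_comm]
  rw [Finset.sum_comm]
  refine Finset.sum_congr rfl fun c _ => Finset.sum_congr rfl fun j _ =>
    Finset.sum_congr rfl fun i _ => by ring

/-- Positivity of a linear map between matrix algebras. -/
def IsPositiveMap (f : Matrix m m ℂ →ₗ[ℂ] Matrix m' m' ℂ) : Prop :=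
  ∀ X : Matrix m m ℂ, X.PosSemidef → (f X).PosSemidef

/-- On a separable output, `R` acts only on the first factor of each product, where positivity is
enough. -/
theorem IsEntanglementBreaking.comp_positive {f : Matrix m m ℂ →ₗ[ℂ] Matrix m' m' ℂ}
    (hf : IsEntanglementBreaking f) {R : Matrix m' m' ℂ →ₗ[ℂ] Matrix m'' m'' ℂ}
    (hR : IsPositiveMap R) : IsCompletelyPositive (R ∘ₗ f) := by
  intro k ρ hρ
  obtain ⟨r, A, B, hA, hB, h⟩ := hf k ρ hρ
  rw [← LinearMap.comp_id (LinearMap.id : Matrix (Fin k) (Fin k) ℂ →ₗ[ℂ] _), tensorMap_comp,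
    LinearMap.comp_apply, h, map_sum]
  refine Matrix.posSemidef_sum _ fun i _ => ?_
  rw [tensorMap_kronecker]
  exact (hR _ (hA i)).kronecker (hB i)

theorem IsEntanglementBreaking.isCompletelyPositive {f : Matrix m m ℂ →ₗ[ℂ] Matrix m' m' ℂ}
    (hf : IsEntanglementBreaking f) : IsCompletelyPositive f := by
  simpa only [LinearMap.id_comp] using hf.comp_positive (R := LinearMap.id) fun _ h => h

theorem IsCompletelyPositive.sum_nonneg {f : Matrix m m ℂ →ₗ[ℂ] Matrix m' m' ℂ}
    (hf : IsCompletelyPositive f) (v : m → m' → ℂ) :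
    0 ≤ ∑ s, ∑ r, ∑ p, ∑ q, star (v s p) * f (Matrix.single s r 1) p q * v r q := by
  let e := Fintype.equivFin m
  -- The unnormalised maximally entangled vector: its projector is sent to the Choi matrix of `f`.
  let w : m × Fin (Fintype.card m) → ℂ := fun x => if x.1 = e.symm x.2 then 1 else 0
  have h := (hf _ _ (Matrix.posSemidef_vecMulVec_self_star w)).dotProduct_mulVec_nonneg
    fun x => v (e.symm x.2) x.1
  convert h using 1
  have hs : ∀ k l, (Matrix.vecMulVec w (star w)).submatrix (fun i => (i, k)) (fun j => (j, l)) =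
      Matrix.single (e.symm k) (e.symm l) 1 := by
    intro k l
    ext i j
    simp only [Matrix.submatrix_apply, Matrix.vecMulVec_apply, Pi.star_apply, w, Matrix.single,
      Matrix.of_apply, apply_ite star, star_one, star_zero]
    by_cases h1 : i = e.symm k <;> by_cases h2 : j = e.symm l <;>
      simp [h1, h2, eq_comm]
  simp only [dotProduct, Matrix.mulVec, Fintype.sum_prod_type, tensorMap_id_right_apply, hs,
    Pi.star_apply, Finset.mul_sum]
  have key : ∀ g : m → m' → m → m' → ℂ, ∑ s, ∑ r, ∑ p, ∑ q, g s p r q =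
      ∑ p, ∑ k, ∑ q, ∑ l, g (e.symm k) p (e.symm l) q := by
    intro g
    simp only [fun p q s => Equiv.sum_comp e.symm fun r => g s p r q]
    simp only [fun p => Equiv.sum_comp e.symm fun s => ∑ q, ∑ r, g s p r q]
    rw [Finset.sum_comm (s := Finset.univ (α := m')) (t := Finset.univ (α := m))]
    refine Finset.sum_congr rfl fun s _ => ?_
    rw [Finset.sum_comm]
    exact Finset.sum_congr rfl fun p _ => Finset.sum_comm
  simpa only [mul_assoc] using
    key fun s p r q => star (v s p) * f (Matrix.single s r 1) p q * v r q

end TensorMap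

/-! ### The commutant of `U ⊗ U` -/

section Commutant

variable {ι V : Type*} [Fintype ι] [DecidableEq ι] [AddCommGroup V] [Module ℂ V]

/-- A family of vectors with four indices, regarded as a `V`-valued matrix on a two-fold tensor
power, commutes with all `U ⊗ U`. -/
def CommutesWithSquares (M : ι → ι → ι → ι → V) : Prop :=
  ∀ U ∈ Matrix.unitaryGroup ι ℂ, ∀ i j k l,
    ∑ a, ∑ b, (U a k * U b l) • M i j a b = ∑ a, ∑ b, (U i a * U j b) • M a b k l

theorem exists_perm_apply_pair {ι : Type*} [DecidableEq ι] {i j k l : ι} (h : i ≠ j) (h' : k ≠ l) :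
    ∃ σ : Equiv.Perm ι, σ i = k ∧ σ j = l := by
  refine ⟨(Equiv.swap i k).trans (Equiv.swap (Equiv.swap i k j) l), ?_, by simp⟩
  have h1 : k ≠ Equiv.swap i k j := fun e => h <| (Equiv.swap i k).injective (by
    rw [Equiv.swap_apply_left]; exact e)
  simp [Equiv.swap_apply_of_ne_of_ne h1 h']

variable {M : ι → ι → ι → ι → V}

theorem CommutesWithSquares.apply_perm (hM : CommutesWithSquares M) (σ : Equiv.Perm ι)
    (i j k l : ι) : M (σ i) (σ j) (σ k) (σ l) = M i j k l := by
  let U : Matrix ι ι ℂ := Matrix.of fun a b => if a = σ b then 1 else 0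
  have hU : U ∈ Matrix.unitaryGroup ι ℂ := by
    rw [Matrix.mem_unitaryGroup_iff']
    ext a b
    simp [U, Matrix.mul_apply, Matrix.star_apply, Matrix.one_apply, apply_ite star, eq_comm]
  have h := hM U hU (σ i) (σ j) k l
  simpa [U, ite_mul, ite_smul] using h

/-- Diagonal unitaries force `{i, j} = {k, l}` as multisets. The phase `I` at `t` is used because
`1`, `I`, `I²` tell the multiplicities 0, 1, 2 apart; `-1` would confuse 0 with 2. -/
theorem CommutesWithSquares.eq_zero (hM : CommutesWithSquares M) {i j k l : ι}
    (h1 : ¬(i = k ∧ j = l)) (h2 : ¬(i = l ∧ j = k)) : M i j k l = 0 := by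
  by_contra hne
  have key : ∀ t, (if k = t then Complex.I else 1) * (if l = t then Complex.I else 1) =
      (if i = t then Complex.I else 1) * (if j = t then Complex.I else 1) := by
    intro t
    let z : ι → ℂ := fun a => if a = t then Complex.I else 1
    have hz : ∀ a, star (z a) * z a = 1 := fun a => by
      by_cases h : a = t <;> simp [z, h]
    have hU : Matrix.diagonal z ∈ Matrix.unitaryGroup ι ℂ := by
      rw [Matrix.mem_unitaryGroup_iff', Matrix.star_eq_conjTranspose,
        Matrix.diagonal_conjTranspose, Matrix.diagonal_mul_diagonal, ← Matrix.diagonal_one]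
      congr 1
      ext a
      exact hz a
    have h := hM _ hU i j k l
    simp only [Matrix.diagonal_apply, ite_mul, zero_mul, mul_ite, mul_zero, ite_smul, zero_smul,
      Finset.sum_ite_eq, Finset.sum_ite_eq', Finset.mem_univ, if_true] at h
    exact smul_left_injective ℂ hne h
  have hI : (1 : ℂ) ≠ Complex.I := fun h => by simpa using congrArg Complex.im h
  have hI' : Complex.I ≠ (1 : ℂ) := hI.symm
  have hI2 : (1 : ℂ) ≠ -1 := by norm_num
  have ki := key i
  have kj := key j
  by_cases a1 : i = k <;> by_cases a2 : j = l <;> by_cases a3 : i = l <;> by_cases a4 : j = k <;>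
    by_cases a5 : i = j <;>
    simp_all [eq_comm]

theorem exists_unitary_entries_ne_zero {i j : ι} (h : i ≠ j) :
    ∃ U ∈ Matrix.unitaryGroup ι ℂ, U i i * U j i ≠ 0 := by
  -- The unitary is the reflection along `v`, with entries `3/5` and `-4/5`. Unequal weights are
  -- needed: along `e_i + e_j` the diagonal entry would vanish.
  let v : ι → ℂ := Pi.single i 1 + Pi.single j 2
  have hv : star v = v := by
    ext a
    by_cases h1 : a = i <;> by_cases h2 : a = j <;> 
      simp [v, Pi.single_apply, h1, h2, apply_ite (starRingEnd ℂ), map_ofNat]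
  have hvv : v ⬝ᵥ v = 5 := by
    simp [v, h, h.symm]; norm_num
  refine ⟨1 - (2 / 5 : ℂ) • Matrix.vecMulVec v v, ?_, ?_⟩
  · rw [Matrix.mem_unitaryGroup_iff']
    have hs : star ((1 : Matrix ι ι ℂ) - (2 / 5 : ℂ) • Matrix.vecMulVec v v) =
        1 - (2 / 5 : ℂ) • Matrix.vecMulVec v v := by
      rw [Matrix.star_eq_conjTranspose, Matrix.conjTranspose_sub, Matrix.conjTranspose_one,
        Matrix.conjTranspose_smul, Matrix.conjTranspose_vecMulVec, hv]
      simp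
    rw [hs, sub_mul, one_mul, mul_sub, mul_one, smul_mul_smul_comm,
      Matrix.vecMulVec_mul_vecMulVec, hvv]
    ext a b
    simp [Matrix.vecMulVec_apply]
    ring
  · simp [v, Matrix.vecMulVec_apply, h, h.symm]
    norm_num

/-- Vector values and the submodule `p` let this be applied first to the `A` indices, with
coefficients that are themselves combinations of the identity and the swap on the `B` indices. -/
theorem CommutesWithSquares.exists_eq (hM : CommutesWithSquares M) (p : Submodule ℂ V)
    (hp : ∀ i j k l, M i j k l ∈ p) :
    ∃ x ∈ p, ∃ y ∈ p, ∀ i j k l, M i j k l =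
      (if i = k ∧ j = l then x else 0) + if i = l ∧ j = k then y else 0 := by
  rcases subsingleton_or_nontrivial ι with hs | hn
  · rcases isEmpty_or_nonempty ι with he | ⟨⟨t⟩⟩
    · exact ⟨0, p.zero_mem, 0, p.zero_mem, fun i => (IsEmpty.false i).elim⟩
    · refine ⟨M t t t t, hp _ _ _ _, 0, p.zero_mem, fun i j k l => ?_⟩
      rw [Subsingleton.elim i t, Subsingleton.elim j t, Subsingleton.elim k t,
        Subsingleton.elim l t]
      simp
  obtain ⟨i₀, j₀, h₀⟩ := exists_pair_ne ι
  refine ⟨M i₀ j₀ i₀ j₀, hp _ _ _ _, M i₀ j₀ j₀ i₀, hp _ _ _ _, fun i j k l => ?_⟩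
  by_cases hij : i = j
  · subst hij
    by_cases hkl : i = k ∧ i = l
    · obtain ⟨rfl, rfl⟩ := hkl
      have h1 : M i i i i = M i₀ i₀ i₀ i₀ := by
        simpa using hM.apply_perm (Equiv.swap i₀ i) i₀ i₀ i₀ i₀
      -- Permutations leave three free values. Comparing the `(i₀ j₀, i₀ i₀)` entries for a unitary
      -- with nonzero `U i₀ i₀ * U j₀ i₀` shows that the fully diagonal one is the sum of the other
      -- two.
      obtain ⟨U, hU, hne⟩ := exists_unitary_entries_ne_zero h₀
      have h2 := hM U hU i₀ j₀ i₀ i₀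
      have hL : ∑ a, ∑ b, (U a i₀ * U b i₀) • M i₀ j₀ a b =
          (U i₀ i₀ * U j₀ i₀) • (M i₀ j₀ i₀ j₀ + M i₀ j₀ j₀ i₀) := by
        have : ∀ a b, (U a i₀ * U b i₀) • M i₀ j₀ a b =
            (if a = i₀ then if b = j₀ then (U a i₀ * U b i₀) • M i₀ j₀ a b else 0 else 0) +
            if a = j₀ then if b = i₀ then (U a i₀ * U b i₀) • M i₀ j₀ a b else 0 else 0 := by
          intro a b
          by_cases e1 : a = i₀ ∧ b = j₀
          · simp [e1.1, e1.2, h₀]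
          · by_cases e2 : a = j₀ ∧ b = i₀
            · simp [e2.1, e2.2, h₀.symm]
            · rw [hM.eq_zero (fun e => e1 ⟨e.1.symm, e.2.symm⟩) fun e => e2 ⟨e.2.symm, e.1.symm⟩]
              simp
        rw [Finset.sum_congr rfl fun a _ => Finset.sum_congr rfl fun b _ => this a b]
        simp only [Finset.sum_add_distrib]
        simp [Finset.sum_ite_irrel, smul_add, mul_comm]
      have hR : ∑ a, ∑ b, (U i₀ a * U j₀ b) • M a b i₀ i₀ =
          (U i₀ i₀ * U j₀ i₀) • M i₀ i₀ i₀ i₀ := by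
        rw [Finset.sum_eq_single i₀, Finset.sum_eq_single i₀]
        · intro b _ hb
          rw [hM.eq_zero (fun e => hb e.2) fun e => hb e.2, smul_zero]
        · simp
        · intro a _ ha
          refine Finset.sum_eq_zero fun b _ => ?_
          rw [hM.eq_zero (fun e => ha e.1) fun e => ha e.1, smul_zero]
        · simp
      rw [hL, hR] at h2
      simp [h1, smul_right_injective V hne h2]
    · have hkl' : ¬(i = l ∧ i = k) := fun h => hkl h.symm
      simp [hM.eq_zero hkl hkl', hkl, hkl']
  · by_cases e1 : i = k ∧ j = l
    · obtain ⟨rfl, rfl⟩ := e1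
      obtain ⟨σ, rfl, rfl⟩ := exists_perm_apply_pair h₀ hij
      simp [hM.apply_perm, h₀]
    · by_cases e2 : i = l ∧ j = k
      · obtain ⟨rfl, rfl⟩ := e2
        obtain ⟨σ, rfl, rfl⟩ := exists_perm_apply_pair h₀ hij
        simp [hM.apply_perm, h₀]
      · simp [hM.eq_zero e1 e2, e1, e2]

end Commutant

/-! ### The convex cone of separable matrices -/

section Separable

variable {m n : Type*}

theorem isSeparable_sum_kronecker {ι : Type*} [Fintype ι] {A : ι → Matrix m m ℂ}
    {B : ι → Matrix n n ℂ} (hA : ∀ i, (A i).PosSemidef) (hB : ∀ i, (B i).PosSemidef) :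
    IsSeparable (∑ i, A i ⊗ₖ B i) := by
  let e := Fintype.equivFin ι
  exact ⟨Fintype.card ι, A ∘ e.symm, B ∘ e.symm, fun i => hA _, fun i => hB _,
    (Equiv.sum_comp e.symm fun i => A i ⊗ₖ B i).symm⟩

theorem isSeparable_kronecker {A : Matrix m m ℂ} {B : Matrix n n ℂ} (hA : A.PosSemidef)
    (hB : B.PosSemidef) : IsSeparable (A ⊗ₖ B) :=
  ⟨1, fun _ => A, fun _ => B, fun _ => hA, fun _ => hB, by simp⟩

theorem IsSeparable.add {J K : Matrix (m × n) (m × n) ℂ} (hJ : IsSeparable J)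
    (hK : IsSeparable K) : IsSeparable (J + K) := by
  obtain ⟨r, A, B, hA, hB, rfl⟩ := hJ
  obtain ⟨s, C, D, hC, hD, rfl⟩ := hK
  have := isSeparable_sum_kronecker (ι := Fin r ⊕ Fin s) (A := Sum.elim A C) (B := Sum.elim B D)
    (by rintro (i | i) <;> simp [hA, hC]) (by rintro (i | i) <;> simp [hB, hD])
  simpa using this

theorem IsSeparable.smul {J : Matrix (m × n) (m × n) ℂ} (hJ : IsSeparable J) {c : ℝ}
    (hc : 0 ≤ c) : IsSeparable (c • J) := by
  obtain ⟨r, A, B, hA, hB, rfl⟩ := hJ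
  refine ⟨r, fun i => c • A i, B, fun i => (hA i).smul hc, hB, ?_⟩
  simp [Finset.smul_sum, Matrix.smul_kronecker]

theorem convex_isSeparable : Convex ℝ {J : Matrix (m × n) (m × n) ℂ | IsSeparable J} :=
  fun _ hJ _ hK _ _ ha hb _ => (IsSeparable.smul hJ ha).add (IsSeparable.smul hK hb)

theorem IsSeparable.conj_kronecker [Fintype m] [Fintype n] {J : Matrix (m × n) (m × n) ℂ}
    (hJ : IsSeparable J) (K : Matrix m m ℂ) (L : Matrix n n ℂ) :
    IsSeparable ((K ⊗ₖ L) * J * star (K ⊗ₖ L)) := by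
  obtain ⟨r, A, B, hA, hB, rfl⟩ := hJ
  refine ⟨r, fun i => K * A i * K.conjTranspose, fun i => L * B i * L.conjTranspose,
    fun i => (hA i).mul_mul_conjTranspose_same K, fun i => (hB i).mul_mul_conjTranspose_same L, ?_⟩
  simp [Finset.mul_sum, Finset.sum_mul, Matrix.star_eq_conjTranspose,
    Matrix.conjTranspose_kronecker, Matrix.mul_kronecker_mul]

end Separable

/-! ### Flip operators and local averaging -/

section Flip

variable {a b : Type*}

/-- On two copies of a bipartite system, exchange the first components if `s`, and the second
components if `t`. -/
def flip (s t : Bool) (x : (a × b) × (a × b)) : (a × b) × (a × b) :=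
  ((if s then x.2.1 else x.1.1, if t then x.2.2 else x.1.2),
    (if s then x.1.1 else x.2.1, if t then x.1.2 else x.2.2))

theorem flip_flip (s t : Bool) (x : (a × b) × (a × b)) : flip s t (flip s t x) = x := by
  cases s <;> cases t <;> rfl

theorem eq_flip_comm {s t : Bool} {x y : (a × b) × (a × b)} : x = flip s t y ↔ y = flip s t x :=
  ⟨fun h => by rw [h, flip_flip], fun h => by rw [h, flip_flip]⟩

variable [Fintype a] [Fintype b]

/-- The trace of `J` against a flip operator. -/
def flipTrace (s t : Bool) (J : Matrix ((a × b) × (a × b)) ((a × b) × (a × b)) ℂ) : ℂ :=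
  ∑ x, J x (flip s t x)

theorem flipTrace_add (s t : Bool) (J K : Matrix ((a × b) × (a × b)) ((a × b) × (a × b)) ℂ) :
    flipTrace s t (J + K) = flipTrace s t J + flipTrace s t K := by
  simp [flipTrace, Finset.sum_add_distrib]

theorem flipTrace_smul (s t : Bool) (c : ℝ)
    (J : Matrix ((a × b) × (a × b)) ((a × b) × (a × b)) ℂ) :
    flipTrace s t (c • J) = c * flipTrace s t J := by
  simp [flipTrace, Finset.mul_sum]

/-- The operator `(U ⊗ V) ⊗ (U ⊗ V)`. -/
def localSquare (U : Matrix a a ℂ) (V : Matrix b b ℂ) :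
    Matrix ((a × b) × (a × b)) ((a × b) × (a × b)) ℂ := (U ⊗ₖ V) ⊗ₖ (U ⊗ₖ V)

theorem localSquare_flip {a b : Type*} (U : Matrix a a ℂ) (V : Matrix b b ℂ) (s t : Bool)
    (x y : (a × b) × (a × b)) :
    localSquare U V (flip s t x) y = localSquare U V x (flip s t y) := by
  cases s <;> cases t <;> simp [localSquare, flip] <;> ring

variable [DecidableEq a] [DecidableEq b]

/-- The linear combination of the four flip operators with the given coefficients. -/
def flipSum (c : Bool → Bool → ℂ) : Matrix ((a × b) × (a × b)) ((a × b) × (a × b)) ℂ :=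
  Matrix.of fun x y => ∑ s, ∑ t, if x = flip s t y then c s t else 0

theorem localSquare_mem_unitaryGroup {U : Matrix a a ℂ} {V : Matrix b b ℂ}
    (hU : U ∈ Matrix.unitaryGroup a ℂ) (hV : V ∈ Matrix.unitaryGroup b ℂ) :
    localSquare U V ∈ Matrix.unitaryGroup ((a × b) × (a × b)) ℂ :=
  Matrix.kronecker_mem_unitary (Matrix.kronecker_mem_unitary hU hV)
    (Matrix.kronecker_mem_unitary hU hV)

/-- Flips commute with `localSquare U V`, so the trace is cyclically invariant under the
conjugation. -/
theorem flipTrace_conj (s t : Bool) (J : Matrix ((a × b) × (a × b)) ((a × b) × (a × b)) ℂ)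
    {U : Matrix a a ℂ} {V : Matrix b b ℂ} (hU : U ∈ Matrix.unitaryGroup a ℂ)
    (hV : V ∈ Matrix.unitaryGroup b ℂ) :
    flipTrace s t (localSquare U V * J * star (localSquare U V)) = flipTrace s t J := by
  set W := localSquare U V with hW
  have h1 : star W * W = 1 :=
    Matrix.mem_unitaryGroup_iff'.1 (localSquare_mem_unitaryGroup hU hV)
  calc flipTrace s t (W * J * star W)
      = ∑ x, ∑ z, (W * J) x z * star (W x (flip s t z)) := by
        simp only [flipTrace, Matrix.mul_apply (M := W * J), Matrix.star_apply]
        simp only [hW, localSquare_flip]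
    _ = ∑ x, (W * (J.submatrix id (flip s t)) * star W) x x := by
        refine Finset.sum_congr rfl fun x _ => ?_
        rw [Matrix.mul_apply (M := W * _)]
        let e : Equiv.Perm ((a × b) × (a × b)) := ⟨flip s t, flip s t, flip_flip s t, flip_flip s t⟩
        rw [← Equiv.sum_comp e]
        refine Finset.sum_congr rfl fun z _ => ?_
        simp [e, flip_flip, Matrix.mul_apply, Matrix.star_apply]
    _ = (J.submatrix id (flip s t)).trace := by
        change (W * (J.submatrix id (flip s t)) * star W).trace = _
        rw [Matrix.trace_mul_comm, ← Matrix.mul_assoc, h1, Matrix.one_mul]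
    _ = flipTrace s t J := rfl

/-- The trace pairing is nondegenerate on the span of the flips: for the difference `Δ`, `tr (Δ Δᴴ)`
is a combination of flip traces of `Δ`, hence zero. The coefficients need not agree, since flips
coincide when a factor has dimension 1. -/
theorem flipSum_eq_of_flipTrace_eq {c d : Bool → Bool → ℂ}
    (h : ∀ s t, flipTrace s t (flipSum (a := a) (b := b) c) =
      flipTrace s t (flipSum (a := a) (b := b) d)) :
    flipSum (a := a) (b := b) c = flipSum d := by
  set Δ : Matrix ((a × b) × (a × b)) ((a × b) × (a × b)) ℂ := flipSum c - flipSum d with hΔ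
  have h0 : ∀ s t, ∑ x, Δ x (flip s t x) = 0 := fun s t => by
    have := h s t
    simp only [flipTrace] at this
    simp [hΔ, Finset.sum_sub_distrib, this]
  have hd : ∀ x y, Δ x y = ∑ s, ∑ t, if y = flip s t x then c s t - d s t else 0 := by
    intro x y
    simp only [hΔ, Matrix.sub_apply, flipSum, Matrix.of_apply, ← Finset.sum_sub_distrib]
    refine Finset.sum_congr rfl fun s _ => Finset.sum_congr rfl fun t _ => ?_
    by_cases hxy : x = flip s t y
    · rw [if_pos hxy, if_pos hxy, if_pos (eq_flip_comm.1 hxy)]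
    · rw [if_neg hxy, if_neg hxy, if_neg (mt eq_flip_comm.2 hxy), sub_zero]
  have ht : (Δ * Δ.conjTranspose).trace = 0 := by
    have : (Δ * Δ.conjTranspose).trace =
        ∑ s, ∑ t, star (c s t - d s t) * ∑ x, Δ x (flip s t x) := by
      have e1 : ∀ x y, Δ x y * star (Δ x y) =
          ∑ s, ∑ t, if y = flip s t x then star (c s t - d s t) * Δ x y else 0 := by
        intro x y
        conv_lhs => rw [hd x y, ← hd x y, mul_comm]
        conv_lhs => enter [1]; rw [hd x y]
        simp only [star_sum, Finset.sum_mul, apply_ite star, star_zero, ite_mul, zero_mul]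
      simp only [Matrix.trace, Matrix.diag, Matrix.mul_apply, Matrix.conjTranspose_apply, e1,
        Finset.mul_sum]
      conv_lhs => enter [2, x]; rw [Finset.sum_comm]; enter [2, s]; rw [Finset.sum_comm]
      rw [Finset.sum_comm]
      refine Finset.sum_congr rfl fun s _ => ?_
      rw [Finset.sum_comm]
      refine Finset.sum_congr rfl fun t _ => Finset.sum_congr rfl fun x _ => ?_
      simp
    rw [this]
    simp [h0]
  rw [Matrix.trace_mul_conjTranspose_self_eq_zero_iff] at ht
  exact sub_eq_zero.1 ht

theorem exists_eq_flipSum {J : Matrix ((a × b) × (a × b)) ((a × b) × (a × b)) ℂ}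
    (hJ : ∀ U ∈ Matrix.unitaryGroup a ℂ, ∀ V ∈ Matrix.unitaryGroup b ℂ,
      J * localSquare U V = localSquare U V * J) : ∃ c, J = flipSum c := by
  -- The `A` indices come outside and the `B` indices form the vector value; commutation with `U ⊗
  -- 1` and with `1 ⊗ V` is then used separately.
  let M : a → a → a → a → (b → b → b → b → ℂ) := fun i i' k k' j j' l l' =>
    J ((i, j), (i', j')) ((k, l), (k', l'))
  have hM : CommutesWithSquares M := by
    intro U hU i i' k k'
    ext j j' l l'
    have := congrFun (congrFun (hJ U hU 1 (one_mem _)) ((i, j), (i', j'))) ((k, l), (k', l'))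
    simp only [Matrix.mul_apply, Fintype.sum_prod_type, localSquare, Matrix.kroneckerMap_apply,
      Matrix.one_apply, mul_ite, ite_mul, mul_one, mul_zero, zero_mul,
      Finset.sum_ite_eq, Finset.sum_ite_eq', Finset.mem_univ, if_true, Finset.sum_ite_irrel,
      Finset.sum_const_zero] at this
    simpa [M, Finset.sum_apply, mul_comm] using this
  let D₀ : b → b → b → b → ℂ := fun j j' l l' => if j = l ∧ j' = l' then 1 else 0
  let D₁ : b → b → b → b → ℂ := fun j j' l l' => if j = l' ∧ j' = l then 1 else 0
  obtain ⟨X, hX, Y, hY, hXY⟩ := hM.exists_eq (Submodule.span ℂ {D₀, D₁}) (by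
    intro i i' k k'
    have hN : CommutesWithSquares (M i i' k k') := by
      intro V hV j j' l l'
      have := congrFun (congrFun (hJ 1 (one_mem _) V hV) ((i, j), (i', j'))) ((k, l), (k', l'))
      simp only [Matrix.mul_apply, Fintype.sum_prod_type, localSquare, Matrix.kroneckerMap_apply,
        Matrix.one_apply, mul_ite, ite_mul, one_mul, mul_zero, zero_mul,
        Finset.sum_ite_eq, Finset.sum_ite_eq', Finset.mem_univ, if_true, Finset.sum_ite_irrel,
        Finset.sum_const_zero] at this
      simpa [M, mul_comm] using this
    obtain ⟨x, -, y, -, hxy⟩ := hN.exists_eq ⊤ fun _ _ _ _ => trivial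
    refine Submodule.mem_span_pair.2 ⟨x, y, ?_⟩
    ext j j' l l'
    simp [hxy, D₀, D₁])
  obtain ⟨x₀, x₁, rfl⟩ := Submodule.mem_span_pair.1 hX
  obtain ⟨y₀, y₁, rfl⟩ := Submodule.mem_span_pair.1 hY
  refine ⟨fun s t => if s then (if t then y₁ else y₀) else if t then x₁ else x₀, ?_⟩
  ext ⟨⟨i, j⟩, i', j'⟩ ⟨⟨k, l⟩, k', l'⟩
  have h1 := congrFun (congrFun (congrFun (congrFun (hXY i i' k k') j) j') l) l'
  simp only [M, D₀, D₁, Pi.add_apply, ite_apply, Pi.smul_apply, Pi.zero_apply, smul_eq_mul,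
    mul_ite, mul_one, mul_zero] at h1
  rw [h1]
  simp only [flipSum, flip, Matrix.of_apply, Fintype.sum_bool, Prod.mk.injEq, if_true,
    Bool.false_eq_true, if_false, and_and_and_comm (a := i = _), ite_and (_ ∧ _) (_ ∧ _)]
  split_ifs <;> ring

theorem isSeparable_flipSum {c : Bool → Bool → ℂ}
    {J : Matrix ((a × b) × (a × b)) ((a × b) × (a × b)) ℂ} (hJ : IsSeparable J)
    (h : ∀ s t, flipTrace s t J = flipTrace s t (flipSum (a := a) (b := b) c)) :
    IsSeparable (flipSum (a := a) (b := b) c) := by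
  -- The orbit of `J` under the local unitary group, whose hull contains an invariant point.
  let S : Set (Matrix ((a × b) × (a × b)) ((a × b) × (a × b)) ℂ) :=
    (fun p : Matrix a a ℂ × Matrix b b ℂ =>
      localSquare p.1 p.2 * J * star (localSquare p.1 p.2)) ''
      ((Matrix.unitaryGroup a ℂ : Set (Matrix a a ℂ)) ×ˢ (Matrix.unitaryGroup b ℂ : Set _))
  have hS : IsCompact S := by
    refine ((isCompact_unitaryGroup a).prod (isCompact_unitaryGroup b)).image ?_
    have : Continuous fun p : Matrix a a ℂ × Matrix b b ℂ => localSquare p.1 p.2 := by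
      refine continuous_matrix fun x y => ?_
      simp only [localSquare, Matrix.kroneckerMap_apply]
      fun_prop
    fun_prop
  have hne : S.Nonempty := ⟨_, (1, 1), ⟨one_mem _, one_mem _⟩, rfl⟩
  obtain ⟨m, hm, hfix⟩ := exists_fixed_point_of_unitary_conj
    (isCompact_convexHull_of_isCompact hS) (convex_convexHull ℝ S) hne.convexHull
  have hmsep : IsSeparable m :=
    convexHull_min (by rintro _ ⟨p, -, rfl⟩; exact hJ.conj_kronecker _ _) convex_isSeparable hm
  have hmtr : ∀ s t, flipTrace s t m = flipTrace s t J := by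
    intro s t
    have hconv : Convex ℝ {K : Matrix ((a × b) × (a × b)) ((a × b) × (a × b)) ℂ |
        flipTrace s t K = flipTrace s t J} := by
      intro K hK L hL u v _ _ huv
      simp only [Set.mem_ofPred_eq] at *
      rw [flipTrace_add, flipTrace_smul, flipTrace_smul, hK, hL, ← add_mul, ← Complex.ofReal_add,
        huv, Complex.ofReal_one, one_mul]
    exact convexHull_min
      (by rintro _ ⟨p, ⟨hp1, hp2⟩, rfl⟩; exact flipTrace_conj s t J hp1 hp2) hconv hm
  obtain ⟨d, rfl⟩ : ∃ d, m = flipSum d := by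
    refine exists_eq_flipSum fun U hU V hV => ?_
    have hW := localSquare_mem_unitaryGroup hU hV
    have := hfix _ hW (fun K hK => by
      let L : Matrix ((a × b) × (a × b)) ((a × b) × (a × b)) ℂ →ₗ[ℝ]
          Matrix ((a × b) × (a × b)) ((a × b) × (a × b)) ℂ :=
        { toFun := fun K => localSquare U V * K * star (localSquare U V)
          map_add' := fun K L => by rw [mul_add, add_mul]
          map_smul' := fun r K => by simp }
      have : L '' convexHull ℝ S ⊆ convexHull ℝ S := by
        rw [L.image_convexHull]
        refine convexHull_mono ?_
        rintro _ ⟨_, ⟨p, ⟨hp1, hp2⟩, rfl⟩, rfl⟩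
        refine ⟨(U * p.1, V * p.2), ⟨mul_mem hU hp1, mul_mem hV hp2⟩, ?_⟩
        simp [L, localSquare, Matrix.mul_kronecker_mul, Matrix.mul_assoc]
      exact this ⟨K, hK, rfl⟩)
    have h1 := Matrix.mem_unitaryGroup_iff'.1 hW
    conv_rhs => rw [← Matrix.mul_one (localSquare U V * m), ← h1, ← Matrix.mul_assoc, this]
  rwa [flipSum_eq_of_flipTrace_eq fun s t => (h s t).symm.trans (hmtr s t).symm]

end Flip

/-! ### The matrix of `Φ` -/

section Phi

theorem tensorMap_oneTr_id_apply {m n : Type*} [Fintype m] [Fintype n] [DecidableEq m]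
    [DecidableEq n] (X : Matrix (m × n) (m × n) ℂ) (p q : m × n) :
    tensorMap (oneTr m) (LinearMap.id : Matrix n n ℂ →ₗ[ℂ] _) X p q =
      if p.1 = q.1 then ∑ i, X (i, p.2) (i, q.2) else 0 := by
  rw [← Prod.mk.eta (p := p), ← Prod.mk.eta (p := q), tensorMap_id_right_apply]
  simp [oneTr, Matrix.trace, Matrix.one_apply]

theorem tensorMap_id_oneTr_apply {m n : Type*} [Fintype m] [Fintype n] [DecidableEq m]
    [DecidableEq n] (X : Matrix (m × n) (m × n) ℂ) (p q : m × n) :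
    tensorMap (LinearMap.id : Matrix m m ℂ →ₗ[ℂ] _) (oneTr n) X p q =
      if p.2 = q.2 then ∑ j, X (p.1, j) (q.1, j) else 0 := by
  rw [← Prod.mk.eta (p := p), ← Prod.mk.eta (p := q), tensorMap_id_left_apply]
  simp [oneTr, Matrix.trace, Matrix.one_apply]

variable {dA dB : ℕ} {α β γ : ℝ}

theorem Phi_apply (X : Matrix (Fin dA × Fin dB) (Fin dA × Fin dB) ℂ) (p q : Fin dA × Fin dB) :
    Phi dA dB α β γ X p q = (if p = q then X.trace else 0) +
      α * (if p.1 = q.1 then ∑ i, X (i, p.2) (i, q.2) else 0) +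
      β * (if p.2 = q.2 then ∑ j, X (p.1, j) (q.1, j) else 0) + γ * X p q := by
  simp only [Phi, LinearMap.add_apply, LinearMap.smul_apply, Matrix.add_apply, Matrix.smul_apply,
    tensorMap_oneTr_id_apply, tensorMap_id_oneTr_apply]
  simp [oneTr, Matrix.one_apply]

theorem Phi_single_apply (x y p q : Fin dA × Fin dB) :
    Phi dA dB α β γ (Matrix.single x y 1) p q =
      (if p = q ∧ x = y then 1 else 0) +
      α * (if (p.1 = q.1 ∧ x.1 = y.1) ∧ p.2 = x.2 ∧ q.2 = y.2 then 1 else 0) +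
      β * (if (p.1 = x.1 ∧ q.1 = y.1) ∧ p.2 = q.2 ∧ x.2 = y.2 then 1 else 0) +
      γ * (if (p.1 = x.1 ∧ q.1 = y.1) ∧ p.2 = x.2 ∧ q.2 = y.2 then 1 else 0) := by
  obtain ⟨x₁, x₂⟩ := x
  obtain ⟨y₁, y₂⟩ := y
  obtain ⟨p₁, p₂⟩ := p
  obtain ⟨q₁, q₂⟩ := q
  rw [Phi_apply]
  have h1 : (Matrix.single (x₁, x₂) (y₁, y₂) (1 : ℂ)).trace =
      if (x₁, x₂) = (y₁, y₂) then 1 else 0 := by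
    split_ifs with h
    · rw [h, Matrix.trace_single_eq_same]
    · exact Matrix.trace_single_eq_of_ne _ _ _ h
  have h2 : ∑ i, Matrix.single (x₁, x₂) (y₁, y₂) (1 : ℂ) (i, p₂) (i, q₂) =
      if x₁ = y₁ ∧ p₂ = x₂ ∧ q₂ = y₂ then 1 else 0 := by
    rw [Finset.sum_eq_single x₁]
    · simp only [Matrix.single, Matrix.of_apply, Prod.mk.injEq, true_and]
      congr 1
      simp only [eq_comm, eq_iff_iff]
      tauto
    · intro i _ hi
      simp [Matrix.single, Ne.symm hi]
    · simp
  have h3 : ∑ j, Matrix.single (x₁, x₂) (y₁, y₂) (1 : ℂ) (p₁, j) (q₁, j) =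
      if x₂ = y₂ ∧ p₁ = x₁ ∧ q₁ = y₁ then 1 else 0 := by
    rw [Finset.sum_eq_single x₂]
    · simp only [Matrix.single, Matrix.of_apply, Prod.mk.injEq, and_true]
      congr 1
      simp only [eq_comm, eq_iff_iff]
      tauto
    · intro i _ hi
      simp [Matrix.single, Ne.symm hi]
    · simp
  have h4 : Matrix.single (x₁, x₂) (y₁, y₂) (1 : ℂ) (p₁, p₂) (q₁, q₂) =
      if (p₁ = x₁ ∧ q₁ = y₁) ∧ p₂ = x₂ ∧ q₂ = y₂ then 1 else 0 := by
    simp only [Matrix.single, Matrix.of_apply, Prod.mk.injEq]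
    congr 1
    simp only [eq_comm, eq_iff_iff]
    tauto
  rw [h1, h2, h3, h4, ← ite_and, ← ite_and, ← ite_and]
  simp only [and_assoc]
  refine congrArg₂ _ (congrArg₂ _ rfl (congrArg _ (if_congr ?_ rfl rfl))) rfl
  tauto

/-- The coefficients of `Φ[α,β,γ]` with respect to the four flip operators. -/
def phiCoeff (α β γ : ℝ) (s t : Bool) : ℂ :=
  if s then (if t then (γ : ℂ) else β) else if t then (α : ℂ) else 1

/-- On each factor, `𝟙 Tr` becomes the identity operator and `I` becomes the swap. -/
theorem mapMatrix_Phi : mapMatrix (Phi dA dB α β γ) = flipSum (phiCoeff α β γ) := by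
  ext ⟨⟨p₁, p₂⟩, x₁, x₂⟩ ⟨⟨q₁, q₂⟩, y₁, y₂⟩
  simp only [mapMatrix, Matrix.of_apply, Phi_single_apply, flipSum, flip, phiCoeff,
    Fintype.sum_bool, Prod.mk.injEq, if_true, Bool.false_eq_true, if_false, mul_ite, mul_one,
    mul_zero, eq_comm (a := y₁) (b := x₁), eq_comm (a := y₂) (b := x₂), eq_comm (a := q₁) (b := x₁),
    eq_comm (a := q₂) (b := x₂), and_and_and_comm]
  ring

end Phi

/-! ### Attainable flip traces -/

section Traces

theorem sum_eq_flip_flip (dA dB : ℕ) (s t s' t' : Bool) :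
    (∑ x : (Fin dA × Fin dB) × (Fin dA × Fin dB),
      if x = flip s' t' (flip s t x) then (1 : ℂ) else 0) =
      (if s = s' then (dA : ℂ) ^ 2 else dA) * if t = t' then (dB : ℂ) ^ 2 else dB := by
  -- Flips compose by `xor`, so only fixed points of one flip are counted: a swapped factor of
  -- dimension `d` contributes `d`, an unswapped one `d ^ 2`.
  have h : ∀ (u v : Bool), (∑ x : (Fin dA × Fin dB) × (Fin dA × Fin dB),
      if x = flip u v x then (1 : ℂ) else 0) =
      (if u then (dA : ℂ) else dA ^ 2) * if v then (dB : ℂ) else dB ^ 2 := by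
    intro u v
    cases u <;> cases v <;>
      simp [Fintype.sum_prod_type, flip, ite_and, eq_comm, -Finset.sum_boole] <;> (ring_nf; try simp)
  have h' : ∀ x : (Fin dA × Fin dB) × (Fin dA × Fin dB),
      flip s' t' (flip s t x) = flip (xor s s') (xor t t') x := by
    intro x
    cases s <;> cases t <;> cases s' <;> cases t' <;> rfl
  simp only [h', h]
  cases s <;> cases t <;> cases s' <;> cases t' <;> simp

theorem flipTrace_flipSum (dA dB : ℕ) (c : Bool → Bool → ℂ) (s t : Bool) :
    flipTrace s t (flipSum (a := Fin dA) (b := Fin dB) c) =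
      ∑ s', ∑ t', c s' t' * ((if s = s' then (dA : ℂ) ^ 2 else dA) *
        if t = t' then (dB : ℂ) ^ 2 else dB) := by
  simp only [flipTrace, flipSum, Matrix.of_apply]
  rw [Finset.sum_comm]
  refine Finset.sum_congr rfl fun s' _ => ?_
  rw [Finset.sum_comm]
  refine Finset.sum_congr rfl fun t' _ => ?_
  rw [← sum_eq_flip_flip, Finset.mul_sum]
  exact Finset.sum_congr rfl fun x _ => by rw [mul_ite, mul_one, mul_zero]

/-- There is a separable matrix with the given traces against the flip operators. -/
def Attains (dA dB : ℕ) (N a b c : ℝ) : Prop :=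
  ∃ J : Matrix ((Fin dA × Fin dB) × (Fin dA × Fin dB)) ((Fin dA × Fin dB) × (Fin dA × Fin dB)) ℂ,
    IsSeparable J ∧ flipTrace false false J = N ∧ flipTrace true false J = a ∧
      flipTrace false true J = b ∧ flipTrace true true J = c

variable {dA dB : ℕ}

theorem Attains.add {N a b c N' a' b' c' : ℝ} (h : Attains dA dB N a b c)
    (h' : Attains dA dB N' a' b' c') : Attains dA dB (N + N') (a + a') (b + b') (c + c') := by
  obtain ⟨J, hJ, h1, h2, h3, h4⟩ := h
  obtain ⟨K, hK, k1, k2, k3, k4⟩ := h'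
  exact ⟨J + K, hJ.add hK, by simp [flipTrace_add, *]⟩

theorem Attains.smul {N a b c r : ℝ} (h : Attains dA dB N a b c) (hr : 0 ≤ r) :
    Attains dA dB (r * N) (r * a) (r * b) (r * c) := by
  obtain ⟨J, hJ, h1, h2, h3, h4⟩ := h
  exact ⟨r • J, hJ.smul hr, by simp [flipTrace_smul, *]⟩

theorem posSemidef_single {n : Type*} [Fintype n] [DecidableEq n] (i : n) :
    (Matrix.single i i (1 : ℂ)).PosSemidef := by
  rw [← Matrix.diagonal_single]
  exact Matrix.PosSemidef.diagonal (Pi.single_nonneg.2 zero_le_one)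

theorem attains_single (p q : Fin dA × Fin dB) :
    Attains dA dB 1 (if p.1 = q.1 then 1 else 0) (if p.2 = q.2 then 1 else 0)
      (if p = q then 1 else 0) := by
  refine ⟨_, isSeparable_kronecker (posSemidef_single p) (posSemidef_single q), ?_⟩
  have h : ∀ s t, flipTrace s t (Matrix.single p p (1 : ℂ) ⊗ₖ Matrix.single q q 1) =
      if (p, q) = flip s t (p, q) then 1 else 0 := by
    intro s t
    rw [flipTrace, Finset.sum_eq_single (p, q)]
    · simp [Matrix.single, flip, Prod.ext_iff, ite_and]
      split_ifs <;> simp_all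
    · rintro ⟨x, y⟩ _ hxy
      simp only [Matrix.kroneckerMap_apply, Matrix.single, Matrix.of_apply]
      by_cases h1 : p = x <;> by_cases h2 : q = y <;> simp_all
    · simp
  obtain ⟨p₁, p₂⟩ := p
  obtain ⟨q₁, q₂⟩ := q
  simp only [h, flip, Prod.mk.injEq]
  refine ⟨?_, ?_, ?_, ?_⟩ <;> simp [eq_comm, apply_ite Complex.ofReal]

theorem sum_val_eq (dA dB : ℕ) :
    ∑ i : Fin dA, ∑ j : Fin dB, (if i.val = j.val then (1 : ℝ) else 0) = (min dA dB : ℕ) := by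
  have h : ∀ i : Fin dA, ∑ j : Fin dB, (if i.val = j.val then (1 : ℝ) else 0) =
      if i.val < dB then 1 else 0 := by
    intro i
    by_cases hi : i.val < dB
    · rw [Finset.sum_eq_single ⟨i.val, hi⟩]
      · simp [hi]
      · intro j _ hj
        rw [if_neg fun e => hj (Fin.ext e.symm)]
      · simp
    · rw [if_neg hi]
      exact Finset.sum_eq_zero fun j _ => if_neg fun e : i.val = j.val => hi (e.trans_lt j.2)
  simp only [h]
  rw [Fin.sum_univ_eq_sum_range (fun i => if i < dB then (1 : ℝ) else 0) dA,
    Finset.sum_boole]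
  congr 1
  rw [← Finset.card_range (min dA dB)]
  congr 1
  ext i
  simp

/-- Two copies of the maximally entangled vector of `A ⊗ B`. The entanglement is inside each copy,
so the matrix is still a product across the cut. -/
theorem attains_maximallyEntangled :
    Attains dA dB ((min dA dB : ℕ) ^ 2) (min dA dB : ℕ) (min dA dB : ℕ) ((min dA dB : ℕ) ^ 2) := by
  let w : Fin dA × Fin dB → ℂ := fun p => if p.1.val = p.2.val then 1 else 0
  have hw : (∑ p, w p) = (min dA dB : ℕ) := by
    have := congrArg Complex.ofReal (sum_val_eq dA dB)
    simpa [w, Fintype.sum_prod_type, apply_ite Complex.ofReal, -Finset.sum_boole,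
      -Nat.cast_min] using this
  have hw2 : ∀ p, w p * w p = w p := fun p => by
    simp [w]
  have hstar : ∀ p, star (w p) = w p := fun p => by simp [w, apply_ite]
  have hmix : ∀ p : Fin dA × Fin dB, ∑ q : Fin dA × Fin dB,
      w p * w q * (w (p.1, q.2) * w (q.1, p.2)) = w p := by
    intro p
    by_cases hp : p.1.val = p.2.val
    · rw [Finset.sum_eq_single p]
      · simp [w, hp]
      · rintro q _ hq
        have : ¬(p.1.val = q.2.val ∧ q.1.val = p.2.val) := fun e =>
          hq (Prod.ext (Fin.ext (e.2.trans hp.symm)) (Fin.ext (e.1.symm.trans hp)))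
        by_cases e1 : p.1.val = q.2.val
        · have e2 : ¬ q.1.val = p.2.val := fun e => this ⟨e1, e⟩
          simp [w, e2]
        · simp [w, e1]
      · simp
    · simp [w, hp]
  refine ⟨_, isSeparable_kronecker (Matrix.posSemidef_vecMulVec_self_star w)
    (Matrix.posSemidef_vecMulVec_self_star w), ?_, ?_, ?_, ?_⟩ <;>
    simp only [flipTrace, flip, Fintype.sum_prod_type (γ := ℂ) (α₁ := Fin dA × Fin dB)
      (α₂ := Fin dA × Fin dB), Matrix.kroneckerMap_apply,
      Matrix.vecMulVec_apply, Pi.star_apply, hstar, if_true, Bool.false_eq_true, if_false]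
  · simp [hw2, ← Finset.mul_sum, ← Finset.sum_mul, hw, sq, -Nat.cast_min]
  · rw [Complex.ofReal_natCast, ← hw]
    refine Finset.sum_congr rfl fun p _ => ?_
    exact (Finset.sum_congr rfl fun q _ => by ring).trans (hmix p)
  · rw [Complex.ofReal_natCast, ← hw]
    refine Finset.sum_congr rfl fun p _ => ?_
    exact (Finset.sum_congr rfl fun q _ => by ring).trans (hmix p)
  · have : ∀ p q : Fin dA × Fin dB, w p * w q * (w q * w p) = w p * w q := fun p q => by
      rw [mul_mul_mul_comm, mul_comm (w q) (w p), ← mul_mul_mul_comm, hw2, hw2]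
    simp [this, ← Finset.mul_sum, ← Finset.sum_mul, hw, sq, -Nat.cast_min]

theorem attains_of_inequalities (hA : 0 < dA) (hB : 0 < dB) {N a b c : ℝ} (hc : 0 ≤ c)
    (hac : c ≤ (min dA dB : ℕ) * a) (hbc : c ≤ (min dA dB : ℕ) * b) (h1 : 0 ≤ N - a - b + c)
    (h2 : 0 ≤ N - a + b - c) (h3 : 0 ≤ N + a - b - c) (hA1 : dA = 1 → N = a ∧ b = c)
    (hB1 : dB = 1 → N = b ∧ a = c) : Attains dA dB N a b c := by
  have v4 : Attains dA dB 1 1 1 1 := by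
    simpa using attains_single (dA := dA) (dB := dB) (⟨0, hA⟩, ⟨0, hB⟩) (⟨0, hA⟩, ⟨0, hB⟩)
  have v2 : 1 < dB → Attains dA dB 1 1 0 0 := fun h => by
    simpa using attains_single (dA := dA) (dB := dB) (⟨0, hA⟩, ⟨0, hB⟩) (⟨0, hA⟩, ⟨1, h⟩)
  have v3 : 1 < dA → Attains dA dB 1 0 1 0 := fun h => by
    simpa using attains_single (dA := dA) (dB := dB) (⟨0, hA⟩, ⟨0, hB⟩) (⟨1, h⟩, ⟨0, hB⟩)
  rcases Nat.eq_or_lt_of_le (Nat.succ_le_of_lt hA) with hA' | hA'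
  · obtain ⟨rfl, rfl⟩ := hA1 hA'.symm
    rw [← hA', min_eq_left (Nat.succ_le_of_lt hB), Nat.succ_eq_add_one, zero_add, Nat.cast_one,
      one_mul] at hac
    rcases Nat.eq_or_lt_of_le (Nat.succ_le_of_lt hB) with hB' | hB'
    · obtain ⟨rfl, -⟩ := hB1 hB'.symm
      simpa using v4.smul hc
    · convert (v4.smul hc).add ((v2 hB').smul (sub_nonneg.2 hac)) using 1 <;> ring
  rcases Nat.eq_or_lt_of_le (Nat.succ_le_of_lt hB) with hB' | hB'
  · obtain ⟨rfl, rfl⟩ := hB1 hB'.symm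
    rw [← hB', min_eq_right (Nat.succ_le_of_lt hA), Nat.succ_eq_add_one, zero_add, Nat.cast_one,
      one_mul] at hbc
    convert (v4.smul hc).add ((v3 hA').smul (sub_nonneg.2 hbc)) using 1 <;> ring
  have v1 : Attains dA dB 1 0 0 0 := by
    simpa using attains_single (dA := dA) (dB := dB) (⟨0, hA⟩, ⟨0, hB⟩) (⟨1, hA'⟩, ⟨1, hB'⟩)
  have hd : 2 ≤ min dA dB := le_min hA' hB'
  have v5 := attains_maximallyEntangled (dA := dA) (dB := dB)
  generalize min dA dB = d at *
  have hd' : (2 : ℝ) ≤ d := by exact_mod_cast hd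
  have hd0 : (0 : ℝ) < d := by linarith
  replace v5 : Attains dA dB 1 (1 / d) (1 / d) 1 := by
    convert v5.smul (r := 1 / (d : ℝ) ^ 2) (by positivity) using 1 <;> field_simp
  have hac' : 0 ≤ a - c / d := by
    rw [sub_nonneg, div_le_iff₀ hd0]; linarith
  have hbc' : 0 ≤ b - c / d := by
    rw [sub_nonneg, div_le_iff₀ hd0]; linarith
  -- With `(1,1/d,1/d,1)` carrying all of `c`, the weight left for `(1,0,0,0)` is this quantity. If
  -- it is negative, `(1,0,0,0)` is dropped and part of `c` moves to `(1,1,1,1)`.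
  by_cases hcase : 0 ≤ N - a - b + 2 * c / d - c
  · convert (((v5.smul hc).add ((v2 hB').smul hac')).add ((v3 hA').smul hbc')).add
      (v1.smul hcase) using 1 <;> ring
  · have hd1 : (0 : ℝ) < 2 * (d - 1) := by linarith
    -- The weight of `(1,1,1,1)`, solved from the four linear equations. `t ≤ c` is where `0 ≤ N - a
    -- - b + c` enters.
    set t := (a + b - 2 * c / d + c - N) * d / (2 * (d - 1)) with ht
    have htt : t * (1 - 1 / d) = (a + b - 2 * c / d + c - N) / 2 := by
      have : (d : ℝ) - 1 ≠ 0 := by linarith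
      rw [ht]; field_simp
    have ht0 : 0 ≤ t := by
      rw [ht]
      refine div_nonneg (mul_nonneg ?_ hd0.le) hd1.le
      push Not at hcase
      linarith
    have htc : 0 ≤ c - t := by
      have h5 : t * (1 - 1 / d) ≤ c * (1 - 1 / d) := by
        rw [htt]
        have : c * (1 - 1 / d) = c - c / d := by ring
        have e : 2 * c / d = 2 * (c / d) := by ring
        rw [this, e]
        linarith
      have h6 : (0 : ℝ) < 1 - 1 / d := by
        rw [sub_pos, div_lt_one hd0]; linarith
      exact sub_nonneg.2 (le_of_mul_le_mul_right h5 h6)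
    convert (((v5.smul htc).add ((v2 hB').smul (r := (N + a - b - c) / 2) (by linarith))).add
      ((v3 hA').smul (r := (N - a + b - c) / 2) (by linarith))).add (v4.smul ht0) using 1
    · ring
    · have : t * (1 - 1 / d) = t - t / d := by ring
      rw [this] at htt
      linear_combination -htt
    · have : t * (1 - 1 / d) = t - t / d := by ring
      rw [this] at htt
      linear_combination -htt
    · ring

end Traces

/-! ### Positivity of the reduction-type maps -/

section Positive

open Matrix

theorem isPositiveMap_transposeMap (m : Type*) [Fintype m] [DecidableEq m] :
    IsPositiveMap (transposeMap m) := fun _ h => h.transpose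

theorem normSq_sum_le {ι : Type*} (s : Finset ι) (f : ι → ℂ) :
    Complex.normSq (∑ i ∈ s, f i) ≤ s.card * ∑ i ∈ s, Complex.normSq (f i) := by
  simp only [Complex.normSq_eq_norm_sq]
  exact (pow_le_pow_left₀ (norm_nonneg _) (norm_sum_le s f) 2).trans sq_sum_le_card_mul_sum_sq

theorem normSq_trace_le_of_mul_conjTranspose_eq_diagonal {m n : Type*} [Fintype m] [Fintype n]
    [DecidableEq m] {X Z : Matrix m n ℂ} {D : m → ℂ} (hX : X * Xᴴ = diagonal D) :
    Complex.normSq (Xᴴ * Z).trace ≤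
      Fintype.card m * ((Xᴴ * Z)ᴴ * (Xᴴ * Z)).trace.re := by
  have h1 : (Xᴴ * Z).trace = ∑ i, ∑ j, star (X i j) * Z i j := by
    simp only [trace, diag, mul_apply, conjTranspose_apply]
    exact Finset.sum_comm
  have hD : ∀ i, D i = ((∑ j, ‖X i j‖ ^ 2 : ℝ) : ℂ) := by
    intro i
    have := congrFun (congrFun hX i) i
    rw [diagonal_apply_eq] at this
    rw [← this]
    simp [mul_apply, Complex.mul_conj, Complex.normSq_eq_norm_sq]
  have h2 : ((Xᴴ * Z)ᴴ * (Xᴴ * Z)).trace.re = ∑ i, (∑ j, ‖X i j‖ ^ 2) * ∑ j, ‖Z i j‖ ^ 2 := by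
    have : (Xᴴ * Z)ᴴ * (Xᴴ * Z) = Zᴴ * (diagonal D * Z) := by
      rw [← hX]; simp [Matrix.mul_assoc]
    rw [this]
    have h3 : (Zᴴ * (diagonal D * Z)).trace =
        ((∑ i, (∑ j, ‖X i j‖ ^ 2) * ∑ j, ‖Z i j‖ ^ 2 : ℝ) : ℂ) := by
      simp only [trace, diag, mul_apply (M := Zᴴ), conjTranspose_apply, diagonal_mul, hD]
      rw [Finset.sum_comm, Complex.ofReal_sum]
      refine Finset.sum_congr rfl fun i _ => ?_
      rw [Complex.ofReal_mul, Complex.ofReal_sum (f := fun j => ‖Z i j‖ ^ 2), Finset.mul_sum]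
      refine Finset.sum_congr rfl fun j _ => ?_
      rw [← Complex.normSq_eq_norm_sq (Z i j), ← Complex.mul_conj]
      simp only [Complex.star_def]
      ring
    rw [h3, Complex.ofReal_re]
  rw [h1, h2]
  refine (normSq_sum_le _ _).trans ?_
  rw [Finset.card_univ]
  refine mul_le_mul_of_nonneg_left (Finset.sum_le_sum fun i _ => ?_) (Nat.cast_nonneg _)
  rw [Complex.normSq_eq_norm_sq]
  calc ‖∑ j, star (X i j) * Z i j‖ ^ 2 ≤ (∑ j, ‖X i j‖ * ‖Z i j‖) ^ 2 := by
        refine pow_le_pow_left₀ (norm_nonneg _) ((norm_sum_le _ _).trans_eq ?_) 2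
        simp
    _ ≤ _ := Finset.sum_mul_sq_le_sq_mul_sq _ _ _

/-- An instance of `|tr Y|² ≤ rank Y · tr (Yᴴ Y)`. Rotating `X` and `Z` by eigenvectors of `X Xᴴ`
makes the rows of `X` orthogonal; Cauchy–Schwarz over rows and within each row finishes. -/
theorem normSq_trace_conjTranspose_mul_le {m n : Type*} [Fintype m] [Fintype n] [DecidableEq m]
    (X Z : Matrix m n ℂ) :
    Complex.normSq (Xᴴ * Z).trace ≤
      Fintype.card m * ((Xᴴ * Z)ᴴ * (Xᴴ * Z)).trace.re := by
  have hH : (X * Xᴴ).IsHermitian := isHermitian_mul_conjTranspose_self X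
  let U : Matrix m m ℂ := hH.eigenvectorUnitary
  have hU : U * Uᴴ = 1 := mem_unitaryGroup_iff.1 hH.eigenvectorUnitary.2
  have hU' : Uᴴ * U = 1 := mem_unitaryGroup_iff'.1 hH.eigenvectorUnitary.2
  have hXZ : Xᴴ * Z = (Uᴴ * X)ᴴ * (Uᴴ * Z) := by
    rw [conjTranspose_mul, conjTranspose_conjTranspose, Matrix.mul_assoc, ← Matrix.mul_assoc U,
      hU, Matrix.one_mul]
  rw [hXZ]
  refine normSq_trace_le_of_mul_conjTranspose_eq_diagonal
    (D := fun i => (hH.eigenvalues i : ℂ)) ?_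
  have h := hH.spectral_theorem
  rw [Unitary.conjStarAlgAut_apply] at h
  change X * Xᴴ = U * _ * Uᴴ at h
  rw [conjTranspose_mul, conjTranspose_conjTranspose]
  calc Uᴴ * X * (Xᴴ * U) = Uᴴ * (X * Xᴴ) * U := by simp only [Matrix.mul_assoc]
    _ = (Uᴴ * U) * diagonal (RCLike.ofReal ∘ hH.eigenvalues) * (Uᴴ * U) :=
        (congrArg (fun M => Uᴴ * M * U) h).trans (by simp only [Matrix.mul_assoc])
    _ = _ := by rw [hU', Matrix.one_mul, Matrix.mul_one]; rfl

theorem tensorMap_id_reductionMap_apply {m : Type*} [Fintype m] [DecidableEq m] (d c : ℕ)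
    (ρ : Matrix (m × Fin d) (m × Fin d) ℂ) (p q : m × Fin d) :
    tensorMap (LinearMap.id : Matrix m m ℂ →ₗ[ℂ] _) (reductionMap d c) ρ p q =
      (if p.2 = q.2 then ∑ j, ρ (p.1, j) (q.1, j) else 0) - 1 / c * ρ p q := by
  rw [← Prod.mk.eta (p := p), ← Prod.mk.eta (p := q), tensorMap_id_left_apply]
  simp [reductionMap, oneTr, Matrix.one_apply, trace]

theorem tensorMap_reductionMap_id_apply {n : Type*} [Fintype n] [DecidableEq n] (d c : ℕ)
    (ρ : Matrix (Fin d × n) (Fin d × n) ℂ) (p q : Fin d × n) :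
    tensorMap (reductionMap d c) (LinearMap.id : Matrix n n ℂ →ₗ[ℂ] _) ρ p q =
      (if p.1 = q.1 then ∑ i, ρ (i, p.2) (i, q.2) else 0) - 1 / c * ρ p q := by
  rw [← Prod.mk.eta (p := p), ← Prod.mk.eta (p := q), tensorMap_id_right_apply]
  simp [reductionMap, oneTr, Matrix.one_apply, trace]

theorem isPositiveMap_tensorMap_id_reductionMap {c : ℕ} (hc : 0 < c) (d : ℕ) :
    IsPositiveMap (tensorMap (LinearMap.id : Matrix (Fin c) (Fin c) ℂ →ₗ[ℂ] _)
      (reductionMap d c)) := by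
  intro ρ hρ
  obtain ⟨r, v, rfl⟩ := posSemidef_iff_eq_sum_vecMulVec.1 hρ
  rw [map_sum]
  refine posSemidef_sum _ fun i _ => ?_
  generalize v i = x
  refine PosSemidef.of_dotProduct_mulVec_nonneg ?_ fun z => ?_
  · ext p q
    simp only [conjTranspose_apply, tensorMap_id_reductionMap_apply, vecMulVec_apply,
      Pi.star_apply, star_sub, star_mul', apply_ite star, star_sum, star_star, star_zero,
      eq_comm (a := q.2)]
    simp [mul_comm]
  -- Vectors of `A ⊗ B` reshaped as matrices: the quadratic form becomes `tr (Yᴴ Y) - |tr Y|² / c`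
  -- with `Y = Xᴴ Z`.
  let X : Matrix (Fin c) (Fin d) ℂ := of fun p k => x (p, k)
  let Z : Matrix (Fin c) (Fin d) ℂ := of fun p k => z (p, k)
  have key := normSq_trace_conjTranspose_mul_le X Z
  have hQ : star z ⬝ᵥ (tensorMap (LinearMap.id : Matrix (Fin c) (Fin c) ℂ →ₗ[ℂ] _)
      (reductionMap d c) (vecMulVec x (star x))) *ᵥ z =
      ((Xᴴ * Z)ᴴ * (Xᴴ * Z)).trace - 1 / c * Complex.normSq (Xᴴ * Z).trace := by
    have e1 : (Xᴴ * Z).trace = ∑ p, star (x p) * z p := by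
      simp only [trace, diag, mul_apply, conjTranspose_apply, Fintype.sum_prod_type, X, Z,
        of_apply]
      exact Finset.sum_comm
    have e2 : ((Xᴴ * Z)ᴴ * (Xᴴ * Z)).trace = ∑ p : Fin c × Fin d, ∑ q : Fin c × Fin d,
        star (z p) * (if p.2 = q.2 then ∑ j, x (p.1, j) * star (x (q.1, j)) else 0) * z q := by
      have : (Xᴴ * Z)ᴴ * (Xᴴ * Z) = Zᴴ * (X * Xᴴ * Z) := by simp [Matrix.mul_assoc]
      rw [this]
      simp only [trace, diag, mul_apply, conjTranspose_apply, Fintype.sum_prod_type, X, Z,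
        of_apply, mul_ite, ite_mul, mul_zero, zero_mul, Finset.sum_ite_eq, Finset.mem_univ,
        if_true, Finset.mul_sum (s := Finset.univ (α := Fin c))]
      rw [Finset.sum_comm]
      exact Finset.sum_congr rfl fun p _ => Finset.sum_congr rfl fun k _ =>
        Finset.sum_congr rfl fun q _ => by ring
    rw [e2, ← Complex.mul_conj, mul_comm (trace _), e1, map_sum, Finset.sum_mul_sum, Finset.mul_sum,
      ← Finset.sum_sub_distrib]
    simp only [dotProduct, mulVec, Finset.mul_sum (s := Finset.univ (α := Fin c × Fin d)),
      ← Finset.sum_sub_distrib, tensorMap_id_reductionMap_apply, vecMulVec_apply, Pi.star_apply]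
    refine Finset.sum_congr rfl fun p _ => Finset.sum_congr rfl fun q _ => ?_
    simp
    split_ifs <;> ring
  have hre : (((Xᴴ * Z)ᴴ * (Xᴴ * Z)).trace.re : ℂ) = ((Xᴴ * Z)ᴴ * (Xᴴ * Z)).trace := by
    have h := (posSemidef_conjTranspose_mul_self (Xᴴ * Z)).trace_nonneg
    exact Complex.ext rfl (Complex.le_def.1 h).2
  rw [hQ, ← hre]
  have hc' : (0 : ℝ) < c := by exact_mod_cast hc
  rw [Fintype.card_fin] at key
  have h : 0 ≤ ((Xᴴ * Z)ᴴ * (Xᴴ * Z)).trace.re - 1 / c * Complex.normSq (Xᴴ * Z).trace := by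
    rw [sub_nonneg, one_div, inv_mul_le_iff₀ hc']
    exact key
  simpa only [Complex.ofReal_sub, Complex.ofReal_mul, Complex.ofReal_div, Complex.ofReal_one,
    Complex.ofReal_natCast] using Complex.zero_le_real.2 h

theorem isPositiveMap_tensorMap_reductionMap_id {c : ℕ} (hc : 0 < c) (d : ℕ) :
    IsPositiveMap (tensorMap (reductionMap d c)
      (LinearMap.id : Matrix (Fin c) (Fin c) ℂ →ₗ[ℂ] _)) := by
  intro ρ hρ
  have h := (isPositiveMap_tensorMap_id_reductionMap hc d _
    (hρ.submatrix Prod.swap)).submatrix Prod.swap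
  convert h using 1
  ext p q
  simp [tensorMap_id_reductionMap_apply, tensorMap_reductionMap_id_apply]

end Positive

/-! ### Inequalities on the parameters -/

section Inequalities

theorem sum_comm_pair {ι κ V : Type*} [Fintype ι] [Fintype κ] [AddCommMonoid V]
    (g : ι → κ → κ → V) : ∑ a, ∑ i, ∑ j, g a i j = ∑ i, ∑ j, ∑ a, g a i j := by
  rw [Finset.sum_comm]
  exact Finset.sum_congr rfl fun i _ => Finset.sum_comm

/-- The Choi matrix tested on the vector `∑ x i • e_{S i} ⊗ e_{P i}`; the inequalities below arise
from particular choices of it. -/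
theorem IsCompletelyPositive.sum_nonneg_of_points {m m' κ : Type*} [Fintype m] [Fintype m']
    [DecidableEq m] [DecidableEq m'] [Fintype κ] {f : Matrix m m ℂ →ₗ[ℂ] Matrix m' m' ℂ}
    (hf : IsCompletelyPositive f) (S : κ → m) (P : κ → m') (x : κ → ℝ) :
    0 ≤ ∑ i, ∑ j, (x i * x j : ℂ) * f (Matrix.single (S i) (S j) 1) (P i) (P j) := by
  have h := hf.sum_nonneg fun s p => ∑ i, if s = S i then if p = P i then (x i : ℂ) else 0 else 0
  convert h using 1
  have key : ∀ s r p q,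
      star (∑ i, if s = S i then if p = P i then (x i : ℂ) else 0 else 0) *
        f (Matrix.single s r 1) p q *
        (∑ j, if r = S j then if q = P j then (x j : ℂ) else 0 else 0) =
      ∑ i, ∑ j, if q = P j then if p = P i then if r = S j then if s = S i then
        (x i * x j : ℂ) * f (Matrix.single s r 1) p q else 0 else 0 else 0 else 0 := by
    intro s r p q
    rw [star_sum, Finset.sum_mul, Finset.sum_mul_sum]
    refine Finset.sum_congr rfl fun i _ => Finset.sum_congr rfl fun j _ => ?_
    split_ifs <;> simp
    ring
  simp only [key, sum_comm_pair (κ := κ), Finset.sum_ite_eq', Finset.mem_univ,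
    if_true]

variable {dA dB : ℕ} {α β γ : ℝ}

theorem nonneg_of_complex_mul_nonneg {r y : ℝ} {z : ℂ} (hz : 0 ≤ z) (hr : 0 < r)
    (h : z = ((r * y : ℝ) : ℂ)) : 0 ≤ y :=
  nonneg_of_mul_nonneg_right (Complex.zero_le_real.1 (h ▸ hz)) hr

theorem IsCompletelyPositive.one_add_nonneg (hf : IsCompletelyPositive (Phi dA dB α β γ))
    (hA : 0 < dA) (hB : 0 < dB) : 0 ≤ 1 + α * dB + β * dA + γ * dA * dB := by
  have h := hf.sum_nonneg_of_points (κ := Fin dA × Fin dB) id id fun _ => 1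
  simp only [Phi_single_apply, id, Fintype.sum_prod_type, Prod.mk.injEq, ite_and, mul_add,
    Finset.sum_add_distrib] at h
  simp [-Finset.sum_boole] at h
  refine nonneg_of_complex_mul_nonneg h (r := dA * dB) (by positivity) ?_
  push_cast
  ring

/-- Test vector: maximally entangled on the copies of `B`, a product of distinct basis vectors on
those of `A`. Distinctness removes the `β` and `γ` terms. -/
theorem IsCompletelyPositive.one_add_left_nonneg (hf : IsCompletelyPositive (Phi dA dB α β γ))
    (hA : 2 ≤ dA) (hB : 0 < dB) : 0 ≤ 1 + α * dB := by
  have h := hf.sum_nonneg_of_points (κ := Fin dB) (fun i => (⟨0, by omega⟩, i))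
    (fun i => (⟨1, by omega⟩, i)) fun _ => 1
  simp [Phi_single_apply, Finset.sum_add_distrib, -Finset.sum_boole] at h
  refine nonneg_of_complex_mul_nonneg h (r := dB) (by positivity) ?_
  push_cast
  ring

theorem IsCompletelyPositive.one_add_right_nonneg (hf : IsCompletelyPositive (Phi dA dB α β γ))
    (hA : 0 < dA) (hB : 2 ≤ dB) : 0 ≤ 1 + β * dA := by
  have h := hf.sum_nonneg_of_points (κ := Fin dA) (fun i => (i, ⟨0, by omega⟩))
    (fun i => (i, ⟨1, by omega⟩)) fun _ => 1
  simp [Phi_single_apply, Finset.sum_add_distrib, -Finset.sum_boole] at h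
  refine nonneg_of_complex_mul_nonneg h (r := dA) (by positivity) ?_
  push_cast
  ring

/-- Test vector: antisymmetric on the copies of `A`, `e₀ ⊗ e₀` on those of `B`. -/
theorem IsPPT.left_nonneg (hf : IsPPT (Phi dA dB α β γ)) (hA : 2 ≤ dA) (hB : 0 < dB) :
    0 ≤ 1 + α - β - γ := by
  have h := hf.sum_nonneg_of_points (κ := Bool)
    (fun i => (if i then ⟨1, by omega⟩ else ⟨0, by omega⟩, ⟨0, hB⟩))
    (fun i => (if i then ⟨0, by omega⟩ else ⟨1, by omega⟩, ⟨0, hB⟩)) fun i => if i then -1 else 1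
  simp [transposeMap, Phi_single_apply] at h
  refine nonneg_of_complex_mul_nonneg h (r := 2) two_pos ?_
  push_cast
  ring

theorem IsPPT.right_nonneg (hf : IsPPT (Phi dA dB α β γ)) (hA : 0 < dA) (hB : 2 ≤ dB) :
    0 ≤ 1 - α + β - γ := by
  have h := hf.sum_nonneg_of_points (κ := Bool)
    (fun i => (⟨0, hA⟩, if i then ⟨1, by omega⟩ else ⟨0, by omega⟩))
    (fun i => (⟨0, hA⟩, if i then ⟨0, by omega⟩ else ⟨1, by omega⟩)) fun i => if i then -1 else 1
  simp [transposeMap, Phi_single_apply] at h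
  refine nonneg_of_complex_mul_nonneg h (r := 2) two_pos ?_
  push_cast
  ring

/-- Test vector: antisymmetric on both pairs. -/
theorem IsPPT.both_nonneg (hf : IsPPT (Phi dA dB α β γ)) (hA : 2 ≤ dA) (hB : 2 ≤ dB) :
    0 ≤ 1 - α - β + γ := by
  have h := hf.sum_nonneg_of_points (κ := Bool × Bool)
    (fun i => (if i.1 then ⟨1, by omega⟩ else ⟨0, by omega⟩,
      if i.2 then ⟨1, by omega⟩ else ⟨0, by omega⟩))
    (fun i => (if i.1 then ⟨0, by omega⟩ else ⟨1, by omega⟩,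
      if i.2 then ⟨0, by omega⟩ else ⟨1, by omega⟩))
    fun i => (if i.1 then -1 else 1) * if i.2 then -1 else 1
  simp [transposeMap, Phi_single_apply, Fintype.sum_prod_type] at h
  refine nonneg_of_complex_mul_nonneg h (r := 4) four_pos ?_
  push_cast
  ring

/-- Tested on the maximally entangled vector, this is `c ≤ dA * a`; CP of `Φ` alone only yields `dB`
in place of `dA`. -/
theorem le_of_isCompletelyPositive_id_reductionMap (hf : IsCompletelyPositive
    (tensorMap LinearMap.id (reductionMap dB dA) ∘ₗ Phi dA dB α β γ)) (hA : 0 < dA)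
    (hB : 0 < dB) :
    1 + α * dB + β * dA + γ * dA * dB ≤ dA * (dB + α + β * dA * dB + γ * dA) := by
  have h := hf.sum_nonneg_of_points (κ := Fin dA × Fin dB) id id fun _ => 1
  simp only [LinearMap.comp_apply, tensorMap_id_reductionMap_apply, id, Fintype.sum_prod_type,
    Finset.sum_sub_distrib, mul_sub, Phi_single_apply, Prod.mk.injEq, ite_and, mul_add,
    Finset.sum_add_distrib] at h
  simp [-Finset.sum_boole, Finset.sum_add_distrib] at h
  rw [← sub_nonneg] at h ⊢
  refine nonneg_of_complex_mul_nonneg h (r := dB) (by positivity) ?_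
  have : (dA : ℂ) ≠ 0 := by exact_mod_cast hA.ne'
  push_cast
  field_simp

theorem le_of_isCompletelyPositive_reductionMap_id (hf : IsCompletelyPositive
    (tensorMap (reductionMap dA dB) LinearMap.id ∘ₗ Phi dA dB α β γ)) (hA : 0 < dA)
    (hB : 0 < dB) :
    1 + α * dB + β * dA + γ * dA * dB ≤ dB * (dA + α * dA * dB + β + γ * dB) := by
  have h := hf.sum_nonneg_of_points (κ := Fin dA × Fin dB) id id fun _ => 1
  simp only [LinearMap.comp_apply, tensorMap_reductionMap_id_apply, id, Fintype.sum_prod_type,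
    Finset.sum_sub_distrib, mul_sub, Phi_single_apply, Prod.mk.injEq, ite_and, mul_add,
    Finset.sum_add_distrib] at h
  simp [-Finset.sum_boole, Finset.sum_add_distrib] at h
  rw [← sub_nonneg] at h ⊢
  refine nonneg_of_complex_mul_nonneg h (r := dA) (by positivity) ?_
  have : (dB : ℂ) ≠ 0 := by exact_mod_cast hB.ne'
  push_cast
  field_simp

theorem IsCompletelyPositive.le_left (hf : IsCompletelyPositive (Phi dA dB α β γ))
    (hA : 0 < dA) (hB : 0 < dB) :
    1 + α * dB + β * dA + γ * dA * dB ≤ dA * (dA + α * dA * dB + β + γ * dB) := by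
  have hA' : (1 : ℝ) ≤ dA := by exact_mod_cast hA
  rw [← sub_nonneg, show dA * (dA + α * dA * dB + β + γ * dB) -
    (1 + α * dB + β * dA + γ * dA * dB) = (dA ^ 2 - 1) * (1 + α * dB) by ring]
  rcases Nat.eq_or_lt_of_le (Nat.succ_le_of_lt hA) with h | h
  · simp [← h]
  · exact mul_nonneg (by nlinarith) (hf.one_add_left_nonneg h hB)

theorem IsCompletelyPositive.le_right (hf : IsCompletelyPositive (Phi dA dB α β γ))
    (hA : 0 < dA) (hB : 0 < dB) :
    1 + α * dB + β * dA + γ * dA * dB ≤ dB * (dB + α + β * dA * dB + γ * dA) := by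
  have hB' : (1 : ℝ) ≤ dB := by exact_mod_cast hB
  rw [← sub_nonneg, show dB * (dB + α + β * dA * dB + γ * dA) -
    (1 + α * dB + β * dA + γ * dA * dB) = (dB ^ 2 - 1) * (1 + β * dA) by ring]
  rcases Nat.eq_or_lt_of_le (Nat.succ_le_of_lt hB) with h | h
  · simp [← h]
  · exact mul_nonneg (by nlinarith) (hf.one_add_right_nonneg hA h)

theorem isEntanglementBreaking_Phi_of_le (hA : 0 < dA) (hB : 0 < dB)
    (hCP : IsCompletelyPositive (Phi dA dB α β γ)) (hPPT : IsPPT (Phi dA dB α β γ))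
    (hac : 1 + α * dB + β * dA + γ * dA * dB ≤
      (min dA dB : ℕ) * (dB + α + β * dA * dB + γ * dA))
    (hbc : 1 + α * dB + β * dA + γ * dA * dB ≤
      (min dA dB : ℕ) * (dA + α * dA * dB + β + γ * dB)) :
    IsEntanglementBreaking (Phi dA dB α β γ) := by
  have hA' : (1 : ℝ) ≤ dA := by exact_mod_cast hA
  have hB' : (1 : ℝ) ≤ dB := by exact_mod_cast hB
  -- These three products are `N - a - b + c`, `N - a + b - c` and `N + a - b - c`. A factor
  -- vanishes in exactly the dimensions where the PPT test vector is unavailable.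
  have h1 : 0 ≤ ((dA : ℝ) - 1) * (dB - 1) * (1 - α - β + γ) := by
    rcases Nat.eq_or_lt_of_le (Nat.succ_le_of_lt hA) with h | h
    · simp [← h]
    rcases Nat.eq_or_lt_of_le (Nat.succ_le_of_lt hB) with h' | h'
    · simp [← h']
    exact mul_nonneg (mul_nonneg (by linarith) (by linarith)) (hPPT.both_nonneg h h')
  have h2 : 0 ≤ ((dA : ℝ) - 1) * (dB + 1) * (1 + α - β - γ) := by
    rcases Nat.eq_or_lt_of_le (Nat.succ_le_of_lt hA) with h | h
    · simp [← h]
    exact mul_nonneg (mul_nonneg (by linarith) (by linarith)) (hPPT.left_nonneg h hB)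
  have h3 : 0 ≤ ((dA : ℝ) + 1) * (dB - 1) * (1 - α + β - γ) := by
    rcases Nat.eq_or_lt_of_le (Nat.succ_le_of_lt hB) with h | h
    · simp [← h]
    exact mul_nonneg (mul_nonneg (by linarith) (by linarith)) (hPPT.right_nonneg hA h)
  have hatt := attains_of_inequalities hA hB (N := dA * dB + α * dA + β * dB + γ)
    (hCP.one_add_nonneg hA hB) hac hbc (by linarith) (by linarith) (by linarith)
    (fun h => by subst h; constructor <;> push_cast <;> ring)
    (fun h => by subst h; constructor <;> push_cast <;> ring)
  -- All four flip traces of the matrix of `Φ` share the factor `dA * dB`, left out of `N, a, b, c`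
  -- and restored here.
  obtain ⟨J, hJ, e1, e2, e3, e4⟩ :=
    hatt.smul (r := dA * dB) (by positivity)
  refine isEntanglementBreaking_of_isSeparable ?_
  rw [mapMatrix_Phi]
  refine isSeparable_flipSum hJ fun s t => ?_
  rw [flipTrace_flipSum]
  cases s <;> cases t <;> simp [e1, e2, e3, e4, phiCoeff] <;> ring

end Inequalities

end BipartiteDepolarizing

end

/-! ### The criteria -/

theorem mainTheorem5 (dA dB : ℕ) (hA : 0 < dA) (hB : 0 < dB) (α β γ : ℝ) :
    (dA = dB →
      (BipartiteDepolarizing.IsEntanglementBreaking (BipartiteDepolarizing.Phi dA dB α β γ) ↔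
        BipartiteDepolarizing.IsCompletelyPositive (BipartiteDepolarizing.Phi dA dB α β γ) ∧
        BipartiteDepolarizing.IsPPT (BipartiteDepolarizing.Phi dA dB α β γ))) ∧
    (dA < dB →
      (BipartiteDepolarizing.IsEntanglementBreaking (BipartiteDepolarizing.Phi dA dB α β γ) ↔
        BipartiteDepolarizing.IsCompletelyPositive (BipartiteDepolarizing.Phi dA dB α β γ) ∧
        BipartiteDepolarizing.IsCompletelyPositive
          (BipartiteDepolarizing.transposeMap (Fin dA × Fin dB) ∘ₗ
            BipartiteDepolarizing.Phi dA dB α β γ) ∧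
        BipartiteDepolarizing.IsCompletelyPositive
          (BipartiteDepolarizing.tensorMap LinearMap.id
              (BipartiteDepolarizing.reductionMap dB dA) ∘ₗ
            BipartiteDepolarizing.Phi dA dB α β γ))) ∧
    (dB < dA →
      (BipartiteDepolarizing.IsEntanglementBreaking (BipartiteDepolarizing.Phi dA dB α β γ) ↔
        BipartiteDepolarizing.IsCompletelyPositive (BipartiteDepolarizing.Phi dA dB α β γ) ∧
        BipartiteDepolarizing.IsCompletelyPositive
          (BipartiteDepolarizing.transposeMap (Fin dA × Fin dB) ∘ₗ
            BipartiteDepolarizing.Phi dA dB α β γ) ∧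
        BipartiteDepolarizing.IsCompletelyPositive
          (BipartiteDepolarizing.tensorMap (BipartiteDepolarizing.reductionMap dA dB)
              LinearMap.id ∘ₗ
            BipartiteDepolarizing.Phi dA dB α β γ))) := by
  have hT := BipartiteDepolarizing.isPositiveMap_transposeMap (Fin dA × Fin dB)
  refine ⟨?_, fun hlt => ⟨fun h => ⟨h.isCompletelyPositive,
    h.comp_positive hT, h.comp_positive
      (BipartiteDepolarizing.isPositiveMap_tensorMap_id_reductionMap hA dB)⟩, ?_⟩,
    fun hlt => ⟨fun h => ⟨h.isCompletelyPositive,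
    h.comp_positive hT, h.comp_positive
      (BipartiteDepolarizing.isPositiveMap_tensorMap_reductionMap_id hB dA)⟩, ?_⟩⟩
  · rintro rfl
    refine ⟨fun h => ⟨h.isCompletelyPositive,
      h.comp_positive hT⟩, fun ⟨h1, h2⟩ => ?_⟩
    refine BipartiteDepolarizing.isEntanglementBreaking_Phi_of_le hA hB h1 h2 ?_ ?_ <;>
      rw [min_self]
    · exact h1.le_right hA hB
    · exact h1.le_left hA hB
  · rintro ⟨h1, h2, h3⟩
    refine BipartiteDepolarizing.isEntanglementBreaking_Phi_of_le hA hB h1 h2 ?_ ?_ <;>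
      rw [min_eq_left hlt.le]
    · exact BipartiteDepolarizing.le_of_isCompletelyPositive_id_reductionMap h3 hA hB
    · exact h1.le_left hA hB
  · rintro ⟨h1, h2, h3⟩
    refine BipartiteDepolarizing.isEntanglementBreaking_Phi_of_le hA hB h1 h2 ?_ ?_ <;>
      rw [min_eq_right hlt.le]
    · exact h1.le_right hA hB
    · exact BipartiteDepolarizing.le_of_isCompletelyPositive_reductionMap_id h3 hA hB
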